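/- **Theorem 1 (Extended circulant Hamiltonian simulation).** Let $n\ge 2$ and $m=\lceil\log_2 n\rceil$. For real numbers $x_1,\dots,x_n\ge 0$ with $\sum_{j=1}^n x_j=1$, let $X$ be the $n\times n$ circulant matrix with first row $(x_1,\dots,x_n)$, i.e. with entries $X_{ab}=x_{((b-a)\bmod n)+1}$, and let $\tilde X=|0\rangle\langle 1|\otimes X+|1\rangle\langle 0|\otimes X^\dagger$ be its extended circulant Hamiltonian, acting on $\mathbb C^2\otimes\mathbb C^n$. An oracle for $X$ is a unitary $O_{\mathbf x}$ on $m$ qubits with $O_{\mathbf x}|0\rangle^{\otimes m}=\sum_{j=1}^n\sqrt{x_j}\,|j-1\rangle$, where $|j-1\rangle$ is the computational basis state given by the binary expansion of $j-1$; nothing is assumed about its action on other states. There is a universal constant $C>0$ such that for all $n\ge 2$, $t>0$ and $\varepsilon>0$ with $\log\log(t/\varepsilon)>0$ there is a quantum circuit, depending only on $n,t,\varepsilon$ (not on $X$ or $O_{\mathbf x}$), that acts on one qubit, an $m$-qubit index register and finitely many ancilla qubits, and consists of - at most $C\,\max(1,t)\,\dfrac{\log(t/\varepsilon)}{\log\log(t/\varepsilon)}$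 calls of controlled-$O_{\mathbf x}$, i.e. $|0\rangle\langle 0|\otimes I+|1\rangle\langle 1|\otimes O_{\mathbf x}$, or of its inverse, and - at most $C\,\max(1,t)\,\log (n)\,\dfrac{\log(t/\varepsilon)}{\log\log(t/\varepsilon)}$ one- or two-qubit gates, such that for every such $X$ and every oracle $O_{\mathbf x}$ for $X$ the circuit implements $e^{-i\tilde Xt}$ within spectral-norm error $\varepsilon$: if $W$ is the unitary performed by the circuit and $E$ is the isometry $|p\rangle|l\rangle\mapsto|p\rangle|l\rangle|0\cdots0\rangle$ ($p\in\{0,1\}$, $0\le l<n$) that encodes $\mathbb C^2\otimes\mathbb C^n$ in the qubits with all ancillas $0$, then $\|WE-E\,e^{-i\tilde Xt}\|\le\varepsilon$. -/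

import Mathlib

open scoped Kronecker Matrix

namespace QSim

/-- Operators on a register of qubits with wire set `ι`, as matrices in the computational basis;
a basis state is an assignment of a bit to every wire. -/
abbrev Operator (ι : Type) : Type := Matrix (ι → Bool) (ι → Bool) ℂ

/-- The computational basis vector `|b⟩`. -/
def ket {ι : Type} [Fintype ι] [DecidableEq ι] (b : ι → Bool) : (ι → Bool) → ℂ :=
  Pi.single b 1

/-- `U` applied to the wires `w`, in the order given by `w`, and the identity on all other wires. -/
def onWires {κ ι : Type} [Fintype κ] [Fintype ι] [DecidableEq ι]
    (w : κ ↪ ι) (U : Operator κ) : Operator ι :=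
  fun a b => if ∀ i, (∀ k, w k ≠ i) → a i = b i then U (a ∘ w) (b ∘ w) else 0

/-- The controlled operator `|0⟩⟨0| ⊗ I + |1⟩⟨1| ⊗ U`; the wire `none` is the control. -/
def controlled {κ : Type} [Fintype κ] [DecidableEq κ] (U : Operator κ) : Operator (Option κ) :=
  fun a b =>
    if a none = b none then
      (if a none = true then U else 1) (a ∘ some) (b ∘ some)
    else 0

/-- One step of a circuit on the wires `ι` with access to an oracle acting on `m` qubits:
an arbitrary one- or two-qubit gate, or one call of the controlled oracle or of its inverse
on chosen distinct wires. The oracle itself is not part of the data. -/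
inductive Step (ι : Type) (m : ℕ) : Type
  | gate₁ (w : Fin 1 ↪ ι) (U : Matrix.unitaryGroup (Fin 1 → Bool) ℂ) : Step ι m
  | gate₂ (w : Fin 2 ↪ ι) (U : Matrix.unitaryGroup (Fin 2 → Bool) ℂ) : Step ι m
  | call (w : Option (Fin m) ↪ ι) : Step ι m
  | callInv (w : Option (Fin m) ↪ ι) : Step ι m

/-- The operator performed by a step, when the oracle is the unitary `O`. -/
def Step.op {ι : Type} [Fintype ι] [DecidableEq ι] {m : ℕ}
    (O : Matrix.unitaryGroup (Fin m → Bool) ℂ) : Step ι m → Operator ι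
  | .gate₁ w U => onWires w U.1
  | .gate₂ w U => onWires w U.1
  | .call w => onWires w (controlled O.1)
  | .callInv w => onWires w (controlled O.1ᴴ)

/-- The number of oracle calls (`0` or `1`) of a step; calls of the inverse count as well. -/
def Step.calls {ι : Type} {m : ℕ} : Step ι m → ℕ
  | .gate₁ _ _ => 0
  | .gate₂ _ _ => 0
  | .call _ => 1
  | .callInv _ => 1

/-- The number of one- or two-qubit gates (`0` or `1`) of a step. -/
def Step.gates {ι : Type} {m : ℕ} : Step ι m → ℕ
  | .gate₁ _ _ => 1
  | .gate₂ _ _ => 1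
  | .call _ => 0
  | .callInv _ => 0

/-- A quantum oracle circuit: a sequence of steps, in the order of time. -/
abbrev Circuit (ι : Type) (m : ℕ) : Type := List (Step ι m)

/-- The operator performed by a circuit; the first step of the list acts first. -/
def Circuit.op {ι : Type} [Fintype ι] [DecidableEq ι] {m : ℕ}
    (O : Matrix.unitaryGroup (Fin m → Bool) ℂ) : Circuit ι m → Operator ι
  | [] => 1
  | s :: c => Circuit.op O c * s.op O

/-- The number of calls of the controlled oracle and its inverse in a circuit. -/
def Circuit.calls {ι : Type} {m : ℕ} (c : Circuit ι m) : ℕ := (c.map Step.calls).sum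

/-- The number of one- or two-qubit gates in a circuit. -/
def Circuit.gates {ι : Type} {m : ℕ} (c : Circuit ι m) : ℕ := (c.map Step.gates).sum

/-- The number `⌈log₂ n⌉` of qubits of an index register. -/
def numQubits (n : ℕ) : ℕ := Nat.clog 2 n

/-- The binary encoding of the index `j ∈ {0, …, n - 1}` (least significant bit first). -/
def bits {n : ℕ} (j : Fin n) : Fin (numQubits n) → Bool := fun i => (j : ℕ).testBit i

/-- `O` prepares the state with amplitudes `√x_j`: it sends `|0…0⟩` to `∑ j, √x_j |j⟩`.
Nothing is assumed about its action on the other basis states. -/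
def PreparesSqrt {n : ℕ} (x : Fin n → ℝ)
    (O : Matrix.unitaryGroup (Fin (numQubits n) → Bool) ℂ) : Prop :=
  O.1 *ᵥ ket (fun _ => false) = ∑ j : Fin n, ((Real.sqrt (x j) : ℝ) : ℂ) • ket (bits j)

/-- The circulant matrix with first row `x`; its entry in row `a` and column `b`
is `x (b - a mod n)`. -/
def circ {n : ℕ} (x : Fin n → ℝ) : Matrix (Fin n) (Fin n) ℂ :=
  (Matrix.circulant fun j => (x j : ℂ))ᵀ

/-- The extended circulant Hamiltonian `|0⟩⟨1| ⊗ X + |1⟩⟨0| ⊗ X†`,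
where `false` stands for `0` and `true` for `1`. -/
def extended {n : ℕ} (X : Matrix (Fin n) (Fin n) ℂ) : Matrix (Bool × Fin n) (Bool × Fin n) ℂ :=
  Matrix.single false true (1 : ℂ) ⊗ₖ X + Matrix.single true false (1 : ℂ) ⊗ₖ Xᴴ

/-- The time evolution `e^{-iHt}`. -/
noncomputable def evolution {κ : Type} [Fintype κ] [DecidableEq κ]
    (H : Matrix κ κ ℂ) (t : ℝ) : Matrix κ κ ℂ :=
  NormedSpace.exp ((-(Complex.I * (t : ℂ))) • H)

/-- The wires of a simulation circuit: the qubit of the dilation, the index register,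
and `a` ancilla qubits. -/
abbrev Wires (n a : ℕ) : Type := Unit ⊕ Fin (numQubits n) ⊕ Fin a

/-- The basis state `|p⟩|l⟩|0…0⟩` of the wires that encodes `(p, l)`, the ancillas being `0`. -/
def encodeBits (n a : ℕ) (v : Bool × Fin n) : Wires n a → Bool
  | .inl _ => v.1
  | .inr (.inl i) => bits v.2 i
  | .inr (.inr _) => false

/-- The isometry `ℂ² ⊗ ℂⁿ → (ℂ²)^{⊗ wires}`, `|p⟩|l⟩ ↦ |p⟩|l⟩|0…0⟩`. -/
def encode (n a : ℕ) : Matrix (Wires n a → Bool) (Bool × Fin n) ℂ :=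
  fun b v => if b = encodeBits n a v then 1 else 0

section
open scoped Matrix.Norms.L2Operator

/-- The spectral norm (operator norm for the Euclidean norms). -/
noncomputable def specNorm {κ μ : Type} [Fintype κ] [Fintype μ] [DecidableEq μ]
    (A : Matrix κ μ ℂ) : ℝ := ‖A‖

end

/-- With oracle `O`, the circuit implements the operator `U` on `ℂ² ⊗ ℂⁿ` within error `ε` in
spectral norm, where the ancillas start in `|0…0⟩` and have to be returned to `|0…0⟩`. -/
def Implements {n a : ℕ} (c : Circuit (Wires n a) (numQubits n))
    (O : Matrix.unitaryGroup (Fin (numQubits n) → Bool) ℂ)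
    (U : Matrix (Bool × Fin n) (Bool × Fin n) ℂ) (ε : ℝ) : Prop :=
  specNorm (Circuit.op O c * encode n a - encode n a * U) ≤ ε

/-- The rate `log (t/ε) / log log (t/ε)`. -/
noncomputable def rate (t ε : ℝ) : ℝ := Real.log (t / ε) / Real.log (Real.log (t / ε))

end QSim

/-! The circuit is a quantum walk followed by quantum signal processing. Let `H` be the extended
Hamiltonian, `S` the shift `|p,l,j⟩ ↦ |!p, l ± j, j⟩` modulo `n` (plus for `p = 0`, minus for `p =
1`), and `R` the reflection about `|0…0⟩` in the oracle register. The walk operator is `G = R O† S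
O`. On encoded vectors `E` the state preparation gives amplitudes `√x_j` twice, so the `|0…0⟩`
component of `O† S O E` is `E H`. Since `R` fixes `E` and `S` is its own inverse on the states that
occur, `G E = R O† S O E` and `G† E = O† S O E`, hence `(G + G†) E = 2 E H`
(`walk_add_conjTranspose_mul_encodeReg`). This relation passes to all powers, so no invariant
two-dimensional subspaces are needed.

Let `T` be a Taylor polynomial of `exp(-itx)` and `P(z) = z^k T((z + 1/z)/2)/s`. Then `P(G) (G†)^k`
compressed to the encoded space is `T(H)/s`. On the unit circle `(z + 1/z)/2` is real and in `[-1,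
1]`, so `|P| < 1` there for `s` slightly above `1`. By `fejer_riesz` there is `Q` with `|P|² + |Q|²
= 1`, and `exists_signalPair` factors the pair `(P, Q)` into `2k + 1` rotations of one control qubit
alternating with controlled applications of `G` (`op_signalCircuit`).

The compression of the circuit is thus `ε²/2`-close to `e^{-iHt}`. As the circuit is unitary, this
forces the circuit itself to be `ε`-close, with clean ancillas (`norm_sub_le_of_isometry`). The
factorial in the Taylor remainder makes `k = O(max(1,t) · rate)` terms suffice
(`pow_div_factorial_numTerms`). Each walk step costs two oracle calls and `O(log n)` gates, since
`S` and `R` are linear-size reversible programs; the modular addition is a ripple-carry adder with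
one correction (`modBit_eq_testBit`, `run_shiftProgram`). -/

namespace QSim

/-! ### Polynomials on the unit circle: Fejér–Riesz and factorization into signal processing steps.
-/

section LaurentPolynomials
open Polynomial ComplexConjugate

/-- The polynomial `z ^ N * conj (A (1 / conj z))`. -/
noncomputable def conjReflect (N : ℕ) (A : ℂ[X]) : ℂ[X] := reflect N (A.map (starRingEnd ℂ))

theorem coeff_conjReflect {N i : ℕ} (A : ℂ[X]) (h : i ≤ N) :
    (conjReflect N A).coeff i = conj (A.coeff (N - i)) := by
  simp [conjReflect, coeff_reflect, revAt_le h]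

theorem natDegree_conjReflect_le {N : ℕ} {A : ℂ[X]} (hA : A.natDegree ≤ N) :
    (conjReflect N A).natDegree ≤ N := by
  refine natDegree_reflect_le.trans (max_le le_rfl ((natDegree_map_le).trans hA))

theorem eval_conjReflect {N : ℕ} {A : ℂ[X]} (hA : A.natDegree ≤ N) {z : ℂ} (hz : z ≠ 0) :
    (conjReflect N A).eval z = z ^ N * conj (A.eval (conj z)⁻¹) := by
  let _ : Invertible z⁻¹ := invertibleOfNonzero (inv_ne_zero hz)
  have h := eval₂_reflect_mul_pow (RingHom.id ℂ) z⁻¹ N (A.map (starRingEnd ℂ))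
    ((natDegree_map_le).trans hA)
  have h2 : eval₂ (RingHom.id ℂ) z⁻¹ (A.map (starRingEnd ℂ)) = conj (A.eval (conj z)⁻¹) := by
    have h3 := hom_eval₂ A (RingHom.id ℂ) (starRingEnd ℂ) (conj z)⁻¹
    rw [map_inv₀, Complex.conj_conj, RingHomCompTriple.comp_eq] at h3
    rw [← eval, eval_map, ← h3, eval]
  rw [h2, ← eval, invOf_eq_inv, inv_inv] at h
  rw [← h, conjReflect, mul_comm (eval _ _), ← mul_assoc, ← mul_pow, mul_inv_cancel₀ hz, one_pow,
    one_mul]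

theorem conj_inv_of_norm_one {z : ℂ} (hz : ‖z‖ = 1) : (conj z)⁻¹ = z := by
  have h0 : z ≠ 0 := by rintro rfl; simp at hz
  have : z * conj z = 1 := by rw [Complex.mul_conj, Complex.normSq_eq_norm_sq, hz]; simp
  exact inv_eq_of_mul_eq_one_left this

theorem eval_conjReflect_of_norm_one {N : ℕ} {A : ℂ[X]} (hA : A.natDegree ≤ N) {z : ℂ}
    (hz : ‖z‖ = 1) : (conjReflect N A).eval z = z ^ N * conj (A.eval z) := by
  have h0 : z ≠ 0 := by rintro rfl; simp at hz
  rw [eval_conjReflect hA h0, conj_inv_of_norm_one hz]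

theorem eq_of_eval_eq_on_circle {A B : ℂ[X]} (h : ∀ z : ℂ, ‖z‖ = 1 → A.eval z = B.eval z) :
    A = B := by
  refine eq_of_infinite_eval_eq A B (Set.Infinite.mono (s := Metric.sphere (0 : ℂ) 1) ?_ ?_)
  · intro z hz
    exact h z (by simpa using hz)
  · have h1 : (Metric.sphere (0 : ℂ) 1).Nontrivial :=
      ⟨1, by simp, -1, by simp, by norm_num⟩
    refine (isPreconnected_sphere ?_ (0 : ℂ) 1).infinite_of_nontrivial h1
    rw [Complex.rank_real_complex]; norm_num

/-- Fejér–Riesz: a trigonometric polynomial that is positive on the circle is the square of the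
absolute value of a polynomial. -/
theorem fejer_riesz (d : ℕ) : ∀ A : ℂ[X], A.natDegree ≤ 2 * d →
    (∀ z : ℂ, ‖z‖ = 1 → ∃ r : ℝ, 0 < r ∧ A.eval z = z ^ d * (r : ℂ)) →
    ∃ Q : ℂ[X], Q.natDegree ≤ d ∧
      ∀ z : ℂ, ‖z‖ = 1 → A.eval z = z ^ d * ((‖Q.eval z‖ ^ 2 : ℝ) : ℂ) := by
  induction d with
  | zero =>
    intro A hA hpos
    obtain ⟨r, hr, h1⟩ := hpos 1 (by simp)
    obtain ⟨c, rfl⟩ : ∃ c, A = C c := ⟨_, eq_C_of_natDegree_le_zero (by simpa using hA)⟩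
    refine ⟨C (Real.sqrt r : ℂ), by simp, fun z _ => ?_⟩
    simp only [eval_C, pow_zero, one_mul] at h1 ⊢
    rw [h1, Complex.norm_real, Real.norm_eq_abs, sq_abs, Real.sq_sqrt hr.le]
  | succ d ih =>
    intro A hA hpos
    have hne : ∀ z : ℂ, ‖z‖ = 1 → A.eval z ≠ 0 := by
      intro z hz h0
      obtain ⟨r, hr, h⟩ := hpos z hz
      have hz0 : z ≠ 0 := by rintro rfl; simp at hz
      rw [h0] at h
      have := mul_ne_zero (pow_ne_zero (d + 1) hz0) (Complex.ofReal_ne_zero.2 hr.ne')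
      exact this h.symm
    -- `A / z^(d+1)` is real on the circle, so `A` is self-reciprocal: its coefficients are
    -- conjugate-symmetric, and its nonzero roots come in pairs `w`, `1 / conj w`.
    have hsymm : conjReflect (2 * (d + 1)) A = A := by
      refine eq_of_eval_eq_on_circle fun z hz => ?_
      rw [eval_conjReflect_of_norm_one hA hz]
      obtain ⟨r, hr, h⟩ := hpos z hz
      have hzz : z * conj z = 1 := by
        rw [Complex.mul_conj, Complex.normSq_eq_norm_sq, hz]; simp
      rw [h, map_mul, map_pow, Complex.conj_ofReal, two_mul, pow_add, mul_assoc,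
        ← mul_assoc (z ^ (d + 1)) (conj z ^ (d + 1)), ← mul_pow, hzz]
      simp
    by_cases h0 : A.coeff 0 = 0
    -- The constant and the top coefficient vanish together, so dividing by `X` lowers the degree
    -- bound by two.
    · have htop : A.coeff (2 * (d + 1)) = 0 := by
        rw [← hsymm, coeff_conjReflect _ le_rfl]; simp [h0]
      obtain ⟨B, rfl⟩ := X_dvd_iff.2 h0
      have hB : B.natDegree ≤ 2 * d := by
        refine natDegree_le_iff_coeff_eq_zero.2 fun k hk => ?_
        rw [← coeff_X_mul]
        rcases Nat.lt_or_ge (2 * (d + 1)) (k + 1) with h | h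
        · exact coeff_eq_zero_of_natDegree_lt (hA.trans_lt h)
        · rw [show k + 1 = 2 * (d + 1) by omega]; exact htop
      obtain ⟨Q, hQ, h⟩ := ih B hB fun z hz => by
        obtain ⟨r, hr, h⟩ := hpos z hz
        have hz0 : z ≠ 0 := by rintro rfl; simp at hz
        refine ⟨r, hr, mul_left_cancel₀ hz0 ?_⟩
        simpa [pow_succ', mul_assoc] using h
      refine ⟨Q, hQ.trans (Nat.le_succ d), fun z hz => ?_⟩
      rw [eval_mul, eval_X, h z hz, pow_succ' z, mul_assoc]
    · have hdeg : A.natDegree = 2 * (d + 1) := by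
        refine le_antisymm hA (le_natDegree_of_ne_zero ?_)
        rw [← hsymm, coeff_conjReflect _ le_rfl]
        simpa using h0
      obtain ⟨w, hw⟩ := Complex.exists_root (f := A)
        (natDegree_pos_iff_degree_pos.1 (by omega))
      have hw0 : w ≠ 0 := by
        rintro rfl
        exact h0 (by rw [coeff_zero_eq_eval_zero]; exact hw)
      have hcw0 : conj w ≠ 0 := by simpa using hw0
      have hw1 : ‖w‖ ≠ 1 := fun h => hne w h hw
      have hww : w ≠ (conj w)⁻¹ := by
        intro h
        apply hw1
        have : w * conj w = 1 := by
          nth_rw 1 [h]; exact inv_mul_cancel₀ hcw0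
        rw [Complex.mul_conj, Complex.normSq_eq_norm_sq] at this
        have h2 : ‖w‖ ^ 2 = 1 := by exact_mod_cast this
        nlinarith [norm_nonneg w]
      have hroot2 : A.IsRoot (conj w)⁻¹ := by
        rw [IsRoot, ← hsymm, eval_conjReflect hA (inv_ne_zero hcw0)]
        have : A.eval w = 0 := hw
        simp [this]
      obtain ⟨A1, hA1⟩ := dvd_iff_isRoot.2 hw
      have hroot3 : A1.IsRoot (conj w)⁻¹ := by
        have h := hroot2
        rw [hA1, IsRoot, eval_mul, mul_eq_zero] at h
        rcases h with h | h
        · exact absurd (sub_eq_zero.1 (by simpa using h)).symm hww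
        · exact h
      obtain ⟨B, rfl⟩ := dvd_iff_isRoot.2 hroot3
      have hB0 : B ≠ 0 := by
        rintro rfl
        apply h0; rw [hA1]; simp
      have hBdeg : B.natDegree = 2 * d := by
        have h := congrArg natDegree hA1
        rw [natDegree_mul (X_sub_C_ne_zero _) (mul_ne_zero (X_sub_C_ne_zero _) hB0),
          natDegree_mul (X_sub_C_ne_zero _) hB0, natDegree_X_sub_C, natDegree_X_sub_C, hdeg] at h
        omega
      -- On the circle `(z - w) (z - 1 / conj w) = -(1 / conj w) z |z - w|²`: a pair of roots
      -- contributes a positive factor that is already a square, and the cofactor inherits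
      -- positivity.
      have hfac : ∀ z : ℂ, ‖z‖ = 1 → A.eval z =
          z * ((‖z - w‖ ^ 2 : ℝ) : ℂ) * ((C (-(conj w)⁻¹) * B).eval z) := by
        intro z hz
        have hzz : z * conj z = 1 := by
          rw [Complex.mul_conj, Complex.normSq_eq_norm_sq, hz]; simp
        rw [hA1, ← Complex.normSq_eq_norm_sq, ← Complex.mul_conj]
        simp only [eval_mul, eval_sub, eval_X, eval_C, map_sub]
        field_simp
        linear_combination (eval z B * (z - w)) * hzz
      have hpos' : ∀ z : ℂ, ‖z‖ = 1 → 0 < ‖z - w‖ ^ 2 := fun z hz => by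
        have : z - w ≠ 0 := by
          rw [sub_ne_zero]; rintro rfl; exact hw1 hz
        positivity
      obtain ⟨Q, hQ, h⟩ := ih (C (-(conj w)⁻¹) * B)
        ((natDegree_C_mul_le _ _).trans hBdeg.le) fun z hz => by
        obtain ⟨r, hr, h⟩ := hpos z hz
        have hz0 : z ≠ 0 := by rintro rfl; simp at hz
        have h3 := hpos' z hz
        refine ⟨r / ‖z - w‖ ^ 2, by positivity, mul_left_cancel₀ hz0
          (mul_left_cancel₀ (Complex.ofReal_ne_zero.2 h3.ne') ?_)⟩
        have h4 : ((‖z - w‖ ^ 2 : ℝ) : ℂ) ≠ 0 := Complex.ofReal_ne_zero.2 h3.ne'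
        rw [Complex.ofReal_div]
        calc _ = A.eval z := by rw [hfac z hz]; ring
          _ = _ := by rw [h]; field_simp; ring
      refine ⟨(X - C w) * Q, ?_, fun z hz => ?_⟩
      · refine natDegree_mul_le.trans ?_
        rw [natDegree_X_sub_C]; omega
      · rw [hfac z hz, h z hz]
        simp only [eval_mul, eval_sub, eval_X, eval_C, norm_mul, mul_pow]
        push_cast
        ring

/-- The pair of polynomials produced by a sequence of signal processing steps: every step
multiplies the second polynomial by the variable and then rotates the pair. -/
noncomputable def signalPair : List (ℂ × ℂ) → ℂ[X] × ℂ[X]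
  | [] => (1, 0)
  | r :: L =>
    (C r.1 * (signalPair L).1 - C (conj r.2) * (X * (signalPair L).2),
      C r.2 * (signalPair L).1 + C (conj r.1) * (X * (signalPair L).2))

/-- The normalized `x` works: one equation is trivial and the other is the orthogonality `h`. If `x
= 0`, a unit vector orthogonal to `y` does. -/
theorem exists_rotation {x y : ℂ × ℂ} (h : y.1 * conj x.1 + y.2 * conj x.2 = 0) :
    ∃ r : ℂ × ℂ, ‖r.1‖ ^ 2 + ‖r.2‖ ^ 2 = 1 ∧ -r.2 * x.1 + r.1 * x.2 = 0 ∧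
      conj r.1 * y.1 + conj r.2 * y.2 = 0 := by
  have key : ∀ u : ℂ × ℂ, u ≠ 0 → -u.2 * x.1 + u.1 * x.2 = 0 →
      conj u.1 * y.1 + conj u.2 * y.2 = 0 → ∃ r : ℂ × ℂ, ‖r.1‖ ^ 2 + ‖r.2‖ ^ 2 = 1 ∧
      -r.2 * x.1 + r.1 * x.2 = 0 ∧ conj r.1 * y.1 + conj r.2 * y.2 = 0 := by
    intro u hu h1 h2
    have hs : 0 < ‖u.1‖ ^ 2 + ‖u.2‖ ^ 2 := by
      rcases eq_or_ne u.1 0 with h | h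
      · have : u.2 ≠ 0 := fun h' => hu (Prod.ext h h')
        positivity
      · positivity
    set s : ℝ := Real.sqrt (‖u.1‖ ^ 2 + ‖u.2‖ ^ 2) with hsdef
    have hs0 : 0 < s := Real.sqrt_pos.2 hs
    have hs2 : s ^ 2 = ‖u.1‖ ^ 2 + ‖u.2‖ ^ 2 := Real.sq_sqrt hs.le
    refine ⟨(((s⁻¹ : ℝ) : ℂ) * u.1, ((s⁻¹ : ℝ) : ℂ) * u.2), ?_, ?_, ?_⟩
    · simp only [norm_mul, Complex.norm_real, Real.norm_eq_abs, mul_pow, sq_abs, ← mul_add, ← hs2]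
      field_simp
    · linear_combination ((s⁻¹ : ℝ) : ℂ) * h1
    · simp only [map_mul, Complex.conj_ofReal]
      linear_combination ((s⁻¹ : ℝ) : ℂ) * h2
  by_cases hx : x = 0
  · subst hx
    by_cases hy : y = 0
    · subst hy
      exact ⟨(1, 0), by simp⟩
    · refine key (-conj y.2, conj y.1) ?_ (by simp) (by simp; ring)
      intro h'
      rw [Prod.mk_eq_zero] at h'
      exact hy (Prod.ext (by simpa using h'.2) (by simpa using h'.1))
  · exact key x hx (by ring) (by linear_combination h)

/-- Every pair of polynomials that is normalized on the circle is produced by a sequence of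
signal processing steps. -/
theorem exists_signalPair (d : ℕ) : ∀ P Q : ℂ[X], P.natDegree ≤ d → Q.natDegree ≤ d →
    (∀ z : ℂ, ‖z‖ = 1 → ‖P.eval z‖ ^ 2 + ‖Q.eval z‖ ^ 2 = 1) →
    ∃ L : List (ℂ × ℂ), L.length = d + 1 ∧ (∀ r ∈ L, ‖r.1‖ ^ 2 + ‖r.2‖ ^ 2 = 1) ∧
      signalPair L = (P, Q) := by
  induction d with
  | zero =>
    intro P Q hP hQ h
    obtain ⟨p, rfl⟩ : ∃ c, P = C c := ⟨_, eq_C_of_natDegree_le_zero hP⟩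
    obtain ⟨q, rfl⟩ : ∃ c, Q = C c := ⟨_, eq_C_of_natDegree_le_zero hQ⟩
    refine ⟨[(p, q)], rfl, ?_, by simp [signalPair]⟩
    simpa using h 1 (by simp)
  | succ d ih =>
    intro P Q hP hQ h
    have hid : P * conjReflect (d + 1) P + Q * conjReflect (d + 1) Q = X ^ (d + 1) := by
      refine eq_of_eval_eq_on_circle fun z hz => ?_
      simp only [eval_add, eval_mul, eval_pow, eval_X, eval_conjReflect_of_norm_one hP hz,
        eval_conjReflect_of_norm_one hQ hz]
      have h1 : ((‖P.eval z‖ ^ 2 + ‖Q.eval z‖ ^ 2 : ℝ) : ℂ) = 1 := by rw [h z hz]; simp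
      rw [← Complex.normSq_eq_norm_sq, ← Complex.normSq_eq_norm_sq, Complex.ofReal_add,
        ← Complex.mul_conj, ← Complex.mul_conj] at h1
      linear_combination z ^ (d + 1) * h1
    -- The coefficient of degree `2 (d + 1)` in `hid` is zero on the right. It says that the vector
    -- of top coefficients of `P, Q` is orthogonal to the vector of constant coefficients, so a
    -- single rotation removes the top coefficient of one polynomial and the constant coefficient of
    -- the other.
    have hc := congrArg (fun R : ℂ[X] => R.coeff ((d + 1) + (d + 1))) hid
    simp only [coeff_add, coeff_X_pow] at hc
    rw [coeff_mul_add_eq_of_natDegree_le hP (natDegree_conjReflect_le hP),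
      coeff_mul_add_eq_of_natDegree_le hQ (natDegree_conjReflect_le hQ), if_neg (by omega),
      coeff_conjReflect _ le_rfl, coeff_conjReflect _ le_rfl, Nat.sub_self] at hc
    obtain ⟨r, hr, h0, htop⟩ := exists_rotation (x := (P.coeff 0, Q.coeff 0))
      (y := (P.coeff (d + 1), Q.coeff (d + 1))) hc
    have hrr : conj r.1 * r.1 + conj r.2 * r.2 = 1 := by
      rw [mul_comm, Complex.mul_conj, mul_comm (conj r.2), Complex.mul_conj,
        Complex.normSq_eq_norm_sq, Complex.normSq_eq_norm_sq, ← Complex.ofReal_add, hr]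
      simp
    have hCC : C (conj r.1) * C r.1 + C (conj r.2) * C r.2 = (1 : ℂ[X]) := by
      rw [← C_mul, ← C_mul, ← C_add, hrr, C_1]
    -- Undoing the rotation and dividing the second component by `X` strips off one step.
    obtain ⟨Q1, hQ1⟩ : X ∣ -C r.2 * P + C r.1 * Q := by
      refine X_dvd_iff.2 ?_
      rw [← C_neg, coeff_add, coeff_C_mul, coeff_C_mul]
      exact h0
    set P1 : ℂ[X] := C (conj r.1) * P + C (conj r.2) * Q with hP1
    have hP1deg : P1.natDegree ≤ d := by
      refine natDegree_le_iff_coeff_eq_zero.2 fun k hk => ?_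
      rcases Nat.lt_or_ge (d + 1) k with h | h
      · rw [hP1, coeff_add, coeff_C_mul, coeff_C_mul,
          coeff_eq_zero_of_natDegree_lt (hP.trans_lt h),
          coeff_eq_zero_of_natDegree_lt (hQ.trans_lt h)]
        simp
      · obtain rfl : k = d + 1 := by omega
        rw [hP1, coeff_add, coeff_C_mul, coeff_C_mul]
        exact htop
    have hQ1deg : Q1.natDegree ≤ d := by
      refine natDegree_le_iff_coeff_eq_zero.2 fun k hk => ?_
      rw [← coeff_X_mul, ← hQ1, ← C_neg, coeff_add, coeff_C_mul, coeff_C_mul,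
        coeff_eq_zero_of_natDegree_lt (hP.trans_lt (by omega)),
        coeff_eq_zero_of_natDegree_lt (hQ.trans_lt (by omega))]
      simp
    obtain ⟨L, hL, hLr, hLP⟩ := ih P1 Q1 hP1deg hQ1deg fun z hz => by
      have h1 : ‖Q1.eval z‖ = ‖(-C r.2 * P + C r.1 * Q).eval z‖ := by
        rw [hQ1, eval_mul, eval_X, norm_mul, hz, one_mul]
      rw [← h z hz, h1, ← Complex.ofReal_inj, hP1]
      push_cast
      simp only [← Complex.mul_conj']
      simp only [eval_add, eval_mul, eval_C, eval_neg, map_add, map_mul, map_neg, Complex.conj_conj]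
      linear_combination (eval z P * conj (eval z P) + eval z Q * conj (eval z Q)) * hrr
    refine ⟨r :: L, by simp [hL], ?_, ?_⟩
    · intro s hs
      rcases List.mem_cons.1 hs with rfl | hs
      · exact hr
      · exact hLr s hs
    · rw [signalPair, hLP, ← hQ1, hP1]
      refine Prod.ext ?_ ?_
      · linear_combination P * hCC
      · linear_combination Q * hCC

end LaurentPolynomials

end QSim

namespace QSim

/-! ### The truncated exponential series, its complement on the circle, and the number of terms. -/

section Truncation
open Polynomial ComplexConjugate Finset

/-- The remainder of the exponential series in a Banach algebra. -/
theorem norm_exp_sub_sum_le {𝔸 : Type*} [NormedRing 𝔸] [NormedAlgebra ℂ 𝔸] [NormOneClass 𝔸]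
    [CompleteSpace 𝔸] (A : 𝔸) {t : ℝ} (hA : ‖A‖ ≤ t) {n : ℕ} (ht : t / (n + 1) ≤ 1 / 2) :
    ‖NormedSpace.exp A - ∑ k ∈ range n, ((k.factorial : ℂ))⁻¹ • A ^ k‖
      ≤ 2 * (t ^ n / n.factorial) := by
  have ht0 : 0 ≤ t := (norm_nonneg A).trans hA
  have hs := NormedSpace.exp_series_hasSum_exp' (𝕂 := ℂ) A
  have hterm : ∀ k : ℕ, ‖((k.factorial : ℂ))⁻¹ • A ^ k‖ ≤ t ^ k / k.factorial := by
    intro k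
    rw [norm_smul, norm_inv, Complex.norm_natCast, div_eq_inv_mul]
    gcongr
    exact (norm_pow_le A k).trans (by gcongr)
  have hr := NormedSpace.exp_series_hasSum_exp' (𝕂 := ℝ) t
  simp only [smul_eq_mul, ← div_eq_inv_mul] at hr
  rw [← Real.exp_eq_exp_ℝ] at hr
  have h1 := (hasSum_nat_add_iff' n).2 hs
  have h2 := (hasSum_nat_add_iff' n).2 hr
  -- Termwise comparison reduces the estimate to the remainder of the real series at `t`.
  have h3 : ‖NormedSpace.exp A - ∑ k ∈ range n, ((k.factorial : ℂ))⁻¹ • A ^ k‖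
      ≤ Real.exp t - ∑ k ∈ range n, t ^ k / k.factorial := by
    rw [← h1.tsum_eq, ← h2.tsum_eq]
    exact tsum_of_norm_bounded h2.summable.hasSum fun k => hterm (k + n)
  refine h3.trans ?_
  have h4 := Complex.exp_bound' (x := (t : ℂ)) (n := n) (by
    rw [Complex.norm_real, Real.norm_of_nonneg ht0]; push_cast; exact ht)
  rw [Complex.norm_real, Real.norm_of_nonneg ht0] at h4
  have h5 : Complex.exp t - ∑ k ∈ range n, (t : ℂ) ^ k / k.factorial
      = ((Real.exp t - ∑ k ∈ range n, t ^ k / k.factorial : ℝ) : ℂ) := by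
    push_cast; rfl
  rw [h5, Complex.norm_real] at h4
  calc _ ≤ _ := le_abs_self _
    _ ≤ _ := h4
    _ = _ := by ring

/-- The Taylor coefficients of `exp (-i t x)`. -/
noncomputable def evolutionCoeff (t : ℝ) (k : ℕ) : ℂ :=
  (-(Complex.I * (t : ℂ))) ^ k * ((k.factorial : ℂ))⁻¹

/-- The polynomial `z ^ n T((z + 1/z)/2) / s`, where `T` is the Taylor polynomial of
`exp (-i t x)` with `n` terms. -/
noncomputable def evolutionPoly (t s : ℝ) (n : ℕ) : ℂ[X] :=
  C ((s : ℂ)⁻¹) *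
    ∑ k ∈ range n, C (evolutionCoeff t k * (2 ^ k)⁻¹) * ((X ^ 2 + 1) ^ k * X ^ (n - k))

theorem natDegree_evolutionPoly_le (t s : ℝ) (n : ℕ) :
    (evolutionPoly t s n).natDegree ≤ 2 * n := by
  refine (natDegree_C_mul_le _ _).trans (natDegree_sum_le_of_forall_le _ _ fun k hk => ?_)
  have hk' := mem_range.1 hk
  refine (natDegree_C_mul_le _ _).trans (natDegree_mul_le.trans ?_)
  have h1 : ((X ^ 2 + 1 : ℂ[X]) ^ k).natDegree ≤ k * 2 := by
    refine natDegree_pow_le.trans (Nat.mul_le_mul_left k ?_)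
    compute_degree
  rw [natDegree_X_pow]
  omega

/-- On the circle `(z + 1/z)/2 = Re z` lies in `[-1, 1]`, where `exp(-itx)` has modulus one, so the
Taylor polynomial exceeds `1` by at most the remainder. -/
theorem norm_eval_evolutionPoly_le {t s : ℝ} (ht0 : 0 ≤ t) (hs : 0 < s) {n : ℕ}
    (ht : t / (n + 1) ≤ 1 / 2) {z : ℂ} (hz : ‖z‖ = 1) :
    ‖(evolutionPoly t s n).eval z‖ ≤ s⁻¹ * (1 + 2 * (t ^ n / n.factorial)) := by
  have hzz : z * conj z = 1 := by
    rw [Complex.mul_conj, Complex.normSq_eq_norm_sq, hz]; simp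
  have hre : z ^ 2 + 1 = 2 * z * (z.re : ℂ) := by
    have h := Complex.add_conj z
    push_cast at h
    linear_combination z * h - hzz
  have hval : (evolutionPoly t s n).eval z =
      (s : ℂ)⁻¹ * z ^ n * ∑ k ∈ range n,
        ((k.factorial : ℂ))⁻¹ • (-(Complex.I * (t : ℂ)) * (z.re : ℂ)) ^ k := by
    simp only [evolutionPoly, eval_mul, eval_C, eval_finsetSum, eval_pow, eval_add, eval_X,
      eval_one, evolutionCoeff, mul_sum]
    refine sum_congr rfl fun k hk => ?_
    have hk' : z ^ n = z ^ k * z ^ (n - k) := by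
      rw [← pow_add, Nat.add_sub_cancel' (mem_range.1 hk).le]
    rw [hre, hk', smul_eq_mul, mul_pow, mul_pow, mul_pow]
    field_simp
  have hx : ‖-(Complex.I * (t : ℂ)) * (z.re : ℂ)‖ ≤ t := by
    rw [norm_mul, norm_neg, norm_mul, Complex.norm_I, one_mul, Complex.norm_real,
      Complex.norm_real, Real.norm_of_nonneg ht0]
    calc t * ‖z.re‖ ≤ t * 1 := by
          gcongr
          rw [Real.norm_eq_abs, ← hz]; exact Complex.abs_re_le_norm z
      _ = t := mul_one t
  have h1 := norm_exp_sub_sum_le _ hx ht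
  have h2 : ‖NormedSpace.exp (-(Complex.I * (t : ℂ)) * (z.re : ℂ))‖ = 1 := by
    rw [← Complex.exp_eq_exp_ℂ, show -(Complex.I * (t : ℂ)) * (z.re : ℂ)
      = ((-(t * z.re) : ℝ) : ℂ) * Complex.I by push_cast; ring]
    exact Complex.norm_exp_ofReal_mul_I _
  rw [hval, norm_mul, norm_mul, norm_pow, hz, one_pow, mul_one, norm_inv, Complex.norm_real,
    Real.norm_of_nonneg hs.le]
  gcongr
  rw [norm_sub_rev] at h1
  calc _ ≤ ‖NormedSpace.exp (-(Complex.I * (t : ℂ)) * (z.re : ℂ))‖ + _ := norm_le_norm_add_norm_sub' _ _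
    _ ≤ _ := by rw [h2]; gcongr

/-- There are signal processing steps for the truncated time evolution. -/
theorem exists_signalPair_evolutionPoly {t s : ℝ} (ht0 : 0 ≤ t) {n : ℕ}
    (ht : t / (n + 1) ≤ 1 / 2) (hs : 1 + 2 * (t ^ n / n.factorial) < s) :
    ∃ L : List (ℂ × ℂ), L.length = 2 * n + 1 ∧ (∀ r ∈ L, ‖r.1‖ ^ 2 + ‖r.2‖ ^ 2 = 1) ∧
      (signalPair L).1 = evolutionPoly t s n := by
  set P := evolutionPoly t s n with hP
  have hs0 : 0 < s := lt_trans (by positivity) hs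
  have hdeg : P.natDegree ≤ 2 * n := natDegree_evolutionPoly_le t s n
  have hlt : ∀ z : ℂ, ‖z‖ = 1 → ‖P.eval z‖ < 1 := fun z hz => by
    refine (norm_eval_evolutionPoly_le ht0 hs0 ht hz).trans_lt ?_
    rw [inv_mul_lt_one₀ hs0]; exact hs
  have heval : ∀ z : ℂ, ‖z‖ = 1 → (X ^ (2 * n) - P * conjReflect (2 * n) P).eval z =
      z ^ (2 * n) * ((1 - ‖P.eval z‖ ^ 2 : ℝ) : ℂ) := fun z hz => by
    rw [eval_sub, eval_mul, eval_conjReflect_of_norm_one hdeg hz, eval_pow, eval_X,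
      ← Complex.normSq_eq_norm_sq, Complex.ofReal_sub, ← Complex.mul_conj]
    push_cast
    ring
  -- The strict inequality for `s` makes `1 - |P|²` positive on the circle; its Fejér–Riesz square
  -- root `Q` completes `P` to a normalized pair.
  obtain ⟨Q, hQ, h⟩ := fejer_riesz (2 * n) (X ^ (2 * n) - P * conjReflect (2 * n) P) (by
      refine (natDegree_sub_le _ _).trans (max_le ?_ (natDegree_mul_le.trans ?_))
      · rw [natDegree_X_pow]; omega
      · have := natDegree_conjReflect_le hdeg
        omega) fun z hz => ⟨1 - ‖P.eval z‖ ^ 2, by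
        have := hlt z hz
        nlinarith [norm_nonneg (P.eval z)], heval z hz⟩
  obtain ⟨L, h1, h2, h3⟩ := exists_signalPair (2 * n) P Q hdeg hQ fun z hz => by
    have h4 := h z hz
    have hz0 : z ≠ 0 := by rintro rfl; simp at hz
    rw [heval z hz] at h4
    have h5 := mul_left_cancel₀ (pow_ne_zero _ hz0) h4
    have h6 : 1 - ‖P.eval z‖ ^ 2 = ‖Q.eval z‖ ^ 2 := by exact_mod_cast h5
    linarith
  exact ⟨L, h1, h2, by rw [h3]⟩

theorem log_le_div_exp_one {x : ℝ} (hx : 0 < x) : Real.log x ≤ x / Real.exp 1 := by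
  have h := Real.log_le_sub_one_of_pos (x := x / Real.exp 1) (by positivity)
  rw [Real.log_div hx.ne' (Real.exp_pos 1).ne', Real.log_exp] at h
  linarith

theorem exp_one_le_rate {t ε : ℝ} (h : 1 < Real.log (t / ε)) : Real.exp 1 ≤ rate t ε := by
  have hl : 0 < Real.log (Real.log (t / ε)) := Real.log_pos h
  rw [rate, le_div_iff₀ hl]
  have := log_le_div_exp_one (x := Real.log (t / ε)) (by linarith)
  rwa [le_div_iff₀ (Real.exp_pos 1), mul_comm] at this

/-- With `L = log (t/ε)`, `log (rate) = log L - log log L`, and `log log L ≤ (log L)/e ≤ (log L)/2`.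
-/
theorem half_log_le_rate_mul_log {t ε : ℝ} (h : 1 < Real.log (t / ε)) :
    Real.log (t / ε) / 2 ≤ rate t ε * Real.log (rate t ε) := by
  have hl : 0 < Real.log (Real.log (t / ε)) := Real.log_pos h
  set L := Real.log (t / ε) with hL
  have h1 := log_le_div_exp_one hl
  have h2 : Real.log L / Real.exp 1 ≤ Real.log L / 2 := by
    gcongr
    linarith [Real.add_one_le_exp 1]
  rw [rate, ← hL, Real.log_div (by linarith) hl.ne']
  calc L / 2 = L / Real.log L * (Real.log L / 2) := by field_simp
    _ ≤ _ := by
      gcongr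
      linarith

/-- The number of terms of the Taylor polynomial that is used. -/
noncomputable def numTerms (t ε : ℝ) : ℕ := ⌈16 * (max 1 t * rate t ε)⌉₊

theorem one_le_max_mul_rate {t ε : ℝ} (h : 1 < Real.log (t / ε)) : 1 ≤ max 1 t * rate t ε := by
  have h1 := exp_one_le_rate h
  have h2 := Real.add_one_le_exp 1
  have h3 : (1 : ℝ) ≤ max 1 t := le_max_left _ _
  nlinarith

theorem numTerms_le {t ε : ℝ} (h : 1 < Real.log (t / ε)) :
    (numTerms t ε : ℝ) ≤ 17 * (max 1 t * rate t ε) := by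
  have h1 := one_le_max_mul_rate h
  have := (Nat.ceil_lt_add_one (a := 16 * (max 1 t * rate t ε)) (by linarith)).le
  rw [numTerms]
  linarith

theorem two_mul_le_numTerms {t ε : ℝ} (ht : 0 < t) (h : 1 < Real.log (t / ε)) :
    2 * t ≤ numTerms t ε := by
  have h1 := exp_one_le_rate h
  have h2 := Real.add_one_le_exp 1
  have h3 : t ≤ max 1 t := le_max_right _ _
  refine le_trans ?_ (Nat.le_ceil _)
  nlinarith

/-- By `n! ≥ (n/e)^n` the remainder is about `(e max(1,t)/n)^n`, and `n` is chosen so that the base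
is at most `1/(e · rate)`. The target is quadratic in `ε` because `norm_sub_le_of_isometry` loses a
square root. -/
theorem pow_div_factorial_numTerms {t ε : ℝ} (ht : 0 < t) (hε : 0 < ε)
    (h : 1 < Real.log (t / ε)) :
    2 * (t ^ numTerms t ε / (numTerms t ε).factorial) < ε ^ 2 / 4 := by
  set n := numTerms t ε with hn
  set ρ := rate t ε with hρ
  set M := max 1 t with hM
  have hM1 : 1 ≤ M := le_max_left _ _
  have hρe : Real.exp 1 ≤ ρ := exp_one_le_rate h
  have he1 : 1 + 1 ≤ Real.exp 1 := Real.add_one_le_exp 1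
  have he3 : Real.exp 1 < 3 := Real.exp_one_lt_three
  have hρ0 : 0 < ρ := by linarith
  have hnM : 16 * (M * ρ) ≤ n := Nat.le_ceil _
  have hnρ : 16 * ρ ≤ n := by nlinarith
  have hn2 : 2 ≤ n := by
    have : (2 : ℝ) ≤ n := by linarith
    exact_mod_cast this
  have hn0 : (0 : ℝ) < n := by linarith
  have hlogρ : 0 ≤ Real.log ρ := Real.log_nonneg (by linarith)
  have hfac : (0 : ℝ) < n.factorial := by exact_mod_cast n.factorial_pos
  have h1 : ((n : ℝ) / Real.exp 1) ^ n ≤ n.factorial := by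
    have := Real.pow_div_factorial_le_exp (n : ℝ) hn0.le n
    rw [div_le_iff₀ hfac] at this
    rw [div_pow, div_le_iff₀ (by positivity), ← Real.exp_nat_mul, mul_one]
    linarith
  -- The factor `t ^ 2` is kept for small `t`: it cancels the denominator of `exp(-2 log(t/ε)) =
  -- ε²/t²`.
  have h2 : t ^ n ≤ t ^ 2 * M ^ n := by
    rcases le_total t 1 with h | h
    · calc t ^ n ≤ t ^ 2 := pow_le_pow_of_le_one ht.le h hn2
        _ ≤ _ := le_mul_of_one_le_right (by positivity) (one_le_pow₀ hM1)
    · rw [hM, max_eq_right h]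
      exact le_mul_of_one_le_left (by positivity) (one_le_pow₀ h)
  have h3 : (Real.exp 1 * M / n) ≤ Real.exp (-(Real.log ρ + 1)) := by
    rw [Real.exp_neg, Real.exp_add, Real.exp_log hρ0, div_le_iff₀ hn0,
      inv_mul_eq_div, le_div_iff₀ (by positivity)]
    have : Real.exp 1 * Real.exp 1 ≤ 16 := by nlinarith
    calc Real.exp 1 * M * (ρ * Real.exp 1) = Real.exp 1 * Real.exp 1 * (M * ρ) := by ring
      _ ≤ 16 * (M * ρ) := by gcongr
      _ ≤ n := hnM
  have h4 : t ^ n / n.factorial ≤ t ^ 2 * Real.exp (-(2 * Real.log (t / ε) + 32)) := by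
    calc t ^ n / n.factorial ≤ (t ^ 2 * M ^ n) / ((n : ℝ) / Real.exp 1) ^ n := by gcongr
      _ = t ^ 2 * (Real.exp 1 * M / n) ^ n := by
          rw [div_pow, div_pow, mul_pow]; field_simp
      _ ≤ t ^ 2 * Real.exp (-(Real.log ρ + 1)) ^ n := by gcongr
      _ ≤ _ := by
          rw [← Real.exp_nat_mul]
          gcongr
          -- `n (log ρ + 1) ≥ 16 ρ log ρ + 16 ρ ≥ 8 log (t/ε) + 32`, more than enough.
          have h5 := half_log_le_rate_mul_log h
          rw [← hρ] at h5
          nlinarith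
  have h6 : Real.exp (-(2 * Real.log (t / ε) + 32)) = ε ^ 2 / t ^ 2 * Real.exp (-32) := by
    rw [neg_add, Real.exp_add, Real.exp_neg, two_mul, Real.exp_add, Real.exp_log (by positivity)]
    field_simp
  have h7 : Real.exp (-32) < 1 / 8 := by
    rw [Real.exp_neg, inv_lt_comm₀ (Real.exp_pos _) (by norm_num)]
    linarith [Real.add_one_le_exp 32]
  rw [h6] at h4
  have h8 : t ^ 2 * (ε ^ 2 / t ^ 2 * Real.exp (-32)) = ε ^ 2 * Real.exp (-32) := by field_simp
  rw [h8] at h4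
  have h9 : ε ^ 2 * Real.exp (-32) < ε ^ 2 * (1 / 8) := by gcongr
  linarith

end Truncation

/-- `2^(m-1) ≤ n` and `2 ≤ n` give `m log 2 ≤ 2 log n`, and `2 / log 2 < 3`. -/
theorem numQubits_le {n : ℕ} (hn : 2 ≤ n) : (numQubits n : ℝ) ≤ 3 * Real.log n := by
  have h2 : 0 < Real.log 2 := Real.log_pos (by norm_num)
  have hl : Real.log 2 ≤ Real.log n := Real.log_le_log (by norm_num) (by exact_mod_cast hn)
  have h1 : (2 : ℝ) ^ (numQubits n - 1) ≤ n := by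
    have := Nat.pow_pred_clog_lt_self (b := 2) (by norm_num) (x := n) (by omega)
    rw [Nat.pred_eq_sub_one] at this
    exact_mod_cast this.le
  have h3 := Real.log_le_log (by positivity) h1
  rw [Real.log_pow] at h3
  have hp : 1 ≤ numQubits n := Nat.clog_pos (by norm_num) hn
  rw [Nat.cast_sub hp] at h3
  have h4 := Real.log_two_gt_d9
  push_cast at h3
  have h5 : ((numQubits n : ℝ)) * Real.log 2 ≤ 2 * Real.log n := by linarith
  nlinarith

end QSim

namespace QSim

set_option linter.unusedSectionVars false

/-! ### Operators on selected wires and their action on basis states. -/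

section Wires

variable {ι κ : Type} [Fintype ι] [DecidableEq ι] [Fintype κ] [DecidableEq κ]

theorem mulVec_ket_apply {μ : Type} (A : Matrix μ (ι → Bool) ℂ) (b : ι → Bool) (a : μ) :
    (A *ᵥ ket b) a = A a b := by
  simp [ket]

theorem ext_ket {μ : Type} {A B : Matrix μ (ι → Bool) ℂ} (h : ∀ b, A *ᵥ ket b = B *ᵥ ket b) :
    A = B := by
  ext a b
  have h1 := congrFun (h b) a
  rwa [mulVec_ket_apply, mulVec_ket_apply] at h1

theorem ket_apply (a b : ι → Bool) : ket b a = if a = b then 1 else 0 := by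
  simp [ket, Pi.single_apply]

theorem extend_agree (w : κ ↪ ι) (z : κ → Bool) (b : ι → Bool) {i : ι} (hi : ∀ k, w k ≠ i) :
    Function.extend w z b i = b i :=
  Function.extend_apply' _ _ _ fun ⟨k, hk⟩ => hi k hk

theorem eq_extend_iff (w : κ ↪ ι) (z : κ → Bool) (a b : ι → Bool) :
    a = Function.extend w z b ↔ (∀ i, (∀ k, w k ≠ i) → a i = b i) ∧ z = a ∘ w := by
  constructor
  · rintro rfl
    refine ⟨fun i hi => extend_agree w z b hi, ?_⟩
    funext k
    simp [w.injective.extend_apply]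
  · rintro ⟨h, rfl⟩
    funext i
    by_cases hi : ∃ k, w k = i
    · obtain ⟨k, rfl⟩ := hi
      simp [w.injective.extend_apply]
    · rw [extend_agree w _ b fun k hk => hi ⟨k, hk⟩]
      exact h i fun k hk => hi ⟨k, hk⟩

theorem onWires_ket (w : κ ↪ ι) (U : Operator κ) (b : ι → Bool) :
    onWires w U *ᵥ ket b = ∑ z, U z (b ∘ w) • ket (Function.extend w z b) := by
  funext a
  rw [mulVec_ket_apply, Finset.sum_apply]
  simp only [Pi.smul_apply, ket_apply, eq_extend_iff, smul_eq_mul, onWires]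
  split_ifs with h
  · simp only [and_iff_right h]
    simp
  · simp only [h, false_and, if_false, mul_zero, Finset.sum_const_zero]

theorem onWires_mul (w : κ ↪ ι) (A B : Operator κ) :
    onWires w (A * B) = onWires w A * onWires w B := by
  refine ext_ket fun b => ?_
  rw [← Matrix.mulVec_mulVec, onWires_ket, onWires_ket, Matrix.mulVec_sum]
  have h1 : ∀ z, Function.extend w z b ∘ w = z := fun z => by
    funext k; simp [w.injective.extend_apply]
  have h2 : ∀ z z', Function.extend w z' (Function.extend w z b) = Function.extend w z' b := by
    intro z z'
    refine (eq_extend_iff w z' _ b).2 ⟨fun i hi => ?_, ?_⟩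
    · rw [extend_agree _ _ _ hi, extend_agree _ _ _ hi]
    · funext k; simp [w.injective.extend_apply]
  simp only [Matrix.mulVec_smul, onWires_ket, h1, h2, Matrix.mul_apply, Finset.sum_smul,
    Finset.smul_sum, smul_smul]
  rw [Finset.sum_comm]
  simp only [mul_comm]

theorem onWires_one (w : κ ↪ ι) : onWires w (1 : Operator κ) = 1 := by
  refine ext_ket fun b => ?_
  rw [onWires_ket, Matrix.one_mulVec, Finset.sum_eq_single (b ∘ w)]
  · rw [Matrix.one_apply_eq, one_smul, ← (eq_extend_iff w (b ∘ w) b b).2 ⟨fun _ _ => rfl, rfl⟩]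
  · intro z _ hz
    rw [Matrix.one_apply_ne hz, zero_smul]
  · simp

theorem onWires_conjTranspose (w : κ ↪ ι) (U : Operator κ) :
    (onWires w U)ᴴ = onWires w Uᴴ := by
  ext a b
  simp only [Matrix.conjTranspose_apply, onWires]
  simp only [eq_comm (a := a _)]
  split_ifs <;> simp

theorem controlled_mul (A B : Operator κ) :
    controlled (A * B) = controlled A * controlled B := by
  ext a b
  rw [Matrix.mul_apply, ← (Equiv.piOptionEquivProd (β := fun _ => Bool)).symm.sum_comp,
    Fintype.sum_prod_type, Fintype.sum_bool]
  simp only [controlled, Equiv.piOptionEquivProd, Equiv.coe_fn_symm_mk]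
  cases ha : a none <;> cases hb : b none <;>
    simp [Function.comp_def, Matrix.one_apply, Matrix.mul_apply]

theorem controlled_one : controlled (1 : Operator κ) = 1 := by
  ext a b
  simp only [controlled, ite_self, Matrix.one_apply]
  by_cases h : a none = b none
  · rw [if_pos h]
    congr 1
    rw [eq_iff_iff, funext_iff, funext_iff]
    constructor
    · rintro h' (_ | i)
      · exact h
      · exact h' i
    · intro h' i
      exact h' (some i)
  · rw [if_neg h, if_neg]
    rintro rfl
    exact h rfl

theorem controlled_conjTranspose (A : Operator κ) :
    (controlled A)ᴴ = controlled Aᴴ := by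
  ext a b
  simp only [Matrix.conjTranspose_apply, controlled]
  cases ha : a none <;> cases hb : b none <;>
    simp [Matrix.one_apply, eq_comm, apply_ite]

theorem onWires_controlled_ket (w : Option κ ↪ ι) (U : Operator κ) (b : ι → Bool) :
    onWires w (controlled U) *ᵥ ket b =
      if b (w none) then onWires ((Function.Embedding.some).trans w) U *ᵥ ket b else ket b := by
  have h0 : ∀ a : ι → Bool, (∀ i, (∀ k, ((Function.Embedding.some).trans w) k ≠ i) → a i = b i) ↔
      (∀ i, (∀ k, w k ≠ i) → a i = b i) ∧ a (w none) = b (w none) := by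
    intro a
    constructor
    · intro h
      refine ⟨fun i hi => h i fun k => hi (some k), h _ fun k hk => ?_⟩
      exact absurd (w.injective hk) (by simp)
    · rintro ⟨h1, h2⟩ i hi
      by_cases h3 : w none = i
      · rw [← h3, h2]
      · refine h1 i ?_
        rintro (_ | k)
        · exact h3
        · exact hi k
  funext a
  rw [mulVec_ket_apply]
  cases hb : b (w none)
  · simp only [onWires, controlled, Function.comp, hb, if_false, Bool.false_eq_true]
    rw [ket_apply]
    by_cases h : a = b
    · subst h; simp [hb]
    · rw [if_neg h]
      split_ifs with h1 h2 h3
      · simp [h2] at h3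
      · rw [Matrix.one_apply_ne]
        intro h4
        apply h
        funext i
        by_cases hi : ∃ k, w k = i
        · obtain ⟨_ | k, rfl⟩ := hi
          · rw [h2, hb]
          · exact congrFun h4 k
        · exact h1 i fun k hk => hi ⟨k, hk⟩
      · rfl
      · rfl
  · simp only [if_true]
    rw [mulVec_ket_apply]
    simp only [onWires, h0, controlled, Function.comp]
    rw [hb]
    by_cases h1 : ∀ i, (∀ k, w k ≠ i) → a i = b i
    · by_cases h2 : a (w none) = true
      · simp [h2, Function.comp_def]
      · simp [h2]
    · simp [h1]

/-- The operator that acts on the wire `t` by a `2 × 2` matrix that depends on the other wires. -/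
def onTarget (t : ι) (F : (ι → Bool) → Matrix Bool Bool ℂ) : Operator ι :=
  fun a b => if ∀ i, i ≠ t → a i = b i then F b (a t) (b t) else 0

theorem eq_update_iff' (t : ι) (c : Bool) (a b : ι → Bool) :
    a = Function.update b t c ↔ (∀ i, i ≠ t → a i = b i) ∧ c = a t := by
  constructor
  · rintro rfl
    simp +contextual
  · rintro ⟨h, rfl⟩
    funext i
    by_cases hi : i = t
    · subst hi; simp
    · rw [Function.update_of_ne hi, h i hi]

theorem onTarget_ket (t : ι) (F : (ι → Bool) → Matrix Bool Bool ℂ) (b : ι → Bool) :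
    onTarget t F *ᵥ ket b = ∑ c, F b c (b t) • ket (Function.update b t c) := by
  funext a
  rw [mulVec_ket_apply, Finset.sum_apply]
  simp only [Pi.smul_apply, ket_apply, eq_update_iff', smul_eq_mul, onTarget]
  split_ifs with h
  · simp only [and_iff_right h]
    simp
  · simp only [h, false_and, if_false, mul_zero, Finset.sum_const_zero]

/-- By `hF` the matrix `F b` ignores the target bit, so it is the same before and after the right
factor has acted. -/
theorem onTarget_mul (t : ι) {F G : (ι → Bool) → Matrix Bool Bool ℂ}
    (hF : ∀ b c, F (Function.update b t c) = F b) :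
    onTarget t F * onTarget t G = onTarget t (fun b => F b * G b) := by
  refine ext_ket fun b => ?_
  rw [← Matrix.mulVec_mulVec, onTarget_ket, onTarget_ket, Matrix.mulVec_sum]
  simp only [Matrix.mulVec_smul, onTarget_ket, hF, Function.update_self, Function.update_idem,
    Matrix.mul_apply, Finset.sum_smul, Finset.smul_sum, smul_smul]
  rw [Finset.sum_comm]
  simp only [mul_comm]

theorem onTarget_one (t : ι) : onTarget t (fun _ => 1) = (1 : Operator ι) := by
  ext a b
  simp only [onTarget, Matrix.one_apply, ← ite_and]
  congr 1
  rw [eq_iff_iff]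
  have h := eq_update_iff' t (b t) a b
  rw [Function.update_eq_self] at h
  rw [h, eq_comm (a := a t)]

theorem onTarget_conjTranspose (t : ι) {F : (ι → Bool) → Matrix Bool Bool ℂ}
    (hF : ∀ b c, F (Function.update b t c) = F b) :
    (onTarget t F)ᴴ = onTarget t (fun b => (F b)ᴴ) := by
  ext a b
  simp only [Matrix.conjTranspose_apply, onTarget]
  by_cases h : ∀ i, i ≠ t → a i = b i
  · rw [if_pos h, if_pos fun i hi => (h i hi).symm]
    have h1 : F a = F b := by rw [(eq_update_iff' t (a t) a b).2 ⟨h, rfl⟩, hF]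
    rw [h1]
  · rw [if_neg h, if_neg fun h' => h fun i hi => (h' i hi).symm, star_zero]

theorem onTarget_mem_unitaryGroup (t : ι) {F : (ι → Bool) → Matrix Bool Bool ℂ}
    (hF : ∀ b c, F (Function.update b t c) = F b) (hU : ∀ b, F b * (F b)ᴴ = 1) :
    onTarget t F ∈ Matrix.unitaryGroup (ι → Bool) ℂ := by
  rw [Matrix.mem_unitaryGroup_iff, Matrix.star_eq_conjTranspose, onTarget_conjTranspose t hF,
    onTarget_mul t hF]
  simp only [hU, onTarget_one]

theorem onWires_onTarget (w : κ ↪ ι) (k : κ)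
    (F : (κ → Bool) → Matrix Bool Bool ℂ) :
    onWires w (onTarget k F) = onTarget (w k) (fun b => F (b ∘ w)) := by
  ext a b
  simp only [onWires, onTarget, Function.comp, ← ite_and]
  congr 1
  rw [eq_iff_iff]
  constructor
  · rintro ⟨h1, h2⟩ i hi
    by_cases h : ∃ k, w k = i
    · obtain ⟨j, rfl⟩ := h
      exact h2 j fun h => hi (by rw [h])
    · exact h1 i fun k hk => h ⟨k, hk⟩
  · intro h
    exact ⟨fun i hi => h i (hi k).symm, fun j hj => h _ fun h' => hj (w.injective h')⟩

end Wires

/-! ### Relabelling of wires. -/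

section Relabel

variable {ι ι' κ : Type} [Fintype ι] [DecidableEq ι] [Fintype ι'] [DecidableEq ι'] [Fintype κ]
  {m : ℕ}

theorem onWires_trans_equiv [DecidableEq κ] (w : κ ↪ ι) (e : ι ≃ ι') (U : Operator κ) :
    onWires (w.trans e.toEmbedding) U =
      (onWires w U).submatrix (fun b => b ∘ e) (fun b => b ∘ e) := by
  ext a b
  simp only [onWires, Matrix.submatrix_apply, Function.Embedding.trans_apply,
    Equiv.coe_toEmbedding, Function.comp]
  congr 1
  rw [eq_iff_iff]
  constructor
  · intro h i hi
    exact h (e i) fun k hk => hi k (e.injective hk)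
  · intro h i hi
    have := h (e.symm i) fun k hk => hi k (by rw [hk, e.apply_symm_apply])
    simpa using this

/-- A step on relabelled wires. -/
def Step.relabel (e : ι ≃ ι') : Step ι m → Step ι' m
  | .gate₁ w U => .gate₁ (w.trans e.toEmbedding) U
  | .gate₂ w U => .gate₂ (w.trans e.toEmbedding) U
  | .call w => .call (w.trans e.toEmbedding)
  | .callInv w => .callInv (w.trans e.toEmbedding)

theorem Step.op_relabel (e : ι ≃ ι') (O : Matrix.unitaryGroup (Fin m → Bool) ℂ) (s : Step ι m) :
    (s.relabel e).op O = (s.op O).submatrix (fun b => b ∘ e) (fun b => b ∘ e) := by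
  cases s <;> exact onWires_trans_equiv _ e _

theorem comp_equiv_bijective (e : ι ≃ ι') :
    Function.Bijective (fun b : ι' → Bool => b ∘ e) :=
  (Equiv.arrowCongr e (Equiv.refl Bool)).symm.bijective

theorem Circuit.op_relabel (e : ι ≃ ι') (O : Matrix.unitaryGroup (Fin m → Bool) ℂ)
    (c : Circuit ι m) :
    Circuit.op O (c.map (Step.relabel e)) =
      (Circuit.op O c).submatrix (fun b => b ∘ e) (fun b => b ∘ e) := by
  induction c with
  | nil =>
    rw [List.map_nil, Circuit.op, Circuit.op,
      Matrix.submatrix_one _ (comp_equiv_bijective e).injective]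
  | cons s c ih =>
    rw [List.map_cons, Circuit.op, Circuit.op, ih, Step.op_relabel,
      Matrix.submatrix_mul _ _ _ _ _ (comp_equiv_bijective e)]

theorem Circuit.calls_relabel (e : ι ≃ ι') (c : Circuit ι m) :
    Circuit.calls (c.map (Step.relabel e)) = Circuit.calls c := by
  rw [Circuit.calls, Circuit.calls, List.map_map]
  congr 2
  funext s
  cases s <;> rfl

theorem Circuit.gates_relabel (e : ι ≃ ι') (c : Circuit ι m) :
    Circuit.gates (c.map (Step.relabel e)) = Circuit.gates c := by
  rw [Circuit.gates, Circuit.gates, List.map_map]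
  congr 2
  funext s
  cases s <;> rfl

end Relabel

/-! ### Composition, unitarity and inversion of circuits. -/

section Circuits

variable {ι : Type} {m : ℕ}

theorem Circuit.calls_append (c c' : Circuit ι m) :
    Circuit.calls (c ++ c') = Circuit.calls c + Circuit.calls c' := by
  simp [Circuit.calls]

theorem Circuit.gates_append (c c' : Circuit ι m) :
    Circuit.gates (c ++ c') = Circuit.gates c + Circuit.gates c' := by
  simp [Circuit.gates]

/-- The inverse of a step. -/
noncomputable def Step.inv : Step ι m → Step ι m
  | .gate₁ w U => .gate₁ w U⁻¹
  | .gate₂ w U => .gate₂ w U⁻¹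
  | .call w => .callInv w
  | .callInv w => .call w

/-- The inverse of a circuit. -/
noncomputable def Circuit.inv (c : Circuit ι m) : Circuit ι m := (c.map Step.inv).reverse

theorem Circuit.calls_inv (c : Circuit ι m) : Circuit.calls (Circuit.inv c) = Circuit.calls c := by
  rw [Circuit.calls, Circuit.calls, Circuit.inv, List.map_reverse, List.sum_reverse, List.map_map]
  congr 2
  funext s
  cases s <;> rfl

theorem Circuit.gates_inv (c : Circuit ι m) : Circuit.gates (Circuit.inv c) = Circuit.gates c := by
  rw [Circuit.gates, Circuit.gates, Circuit.inv, List.map_reverse, List.sum_reverse, List.map_map]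
  congr 2
  funext s
  cases s <;> rfl

variable [Fintype ι] [DecidableEq ι] (O : Matrix.unitaryGroup (Fin m → Bool) ℂ)

theorem Circuit.op_append (c c' : Circuit ι m) :
    Circuit.op O (c ++ c') = Circuit.op O c' * Circuit.op O c := by
  induction c with
  | nil => simp [Circuit.op]
  | cons s c ih => rw [List.cons_append, Circuit.op, Circuit.op, ih, Matrix.mul_assoc]

theorem onWires_mul_conjTranspose {κ : Type} [Fintype κ] [DecidableEq κ] (w : κ ↪ ι)
    {U : Operator κ} (hU : U * Uᴴ = 1) : onWires w U * (onWires w U)ᴴ = 1 := by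
  rw [onWires_conjTranspose, ← onWires_mul, hU, onWires_one]

theorem unitary_mul_conjTranspose {κ : Type} [Fintype κ] [DecidableEq κ]
    (U : Matrix.unitaryGroup κ ℂ) : U.1 * U.1ᴴ = 1 :=
  Matrix.mem_unitaryGroup_iff.1 U.2

theorem unitary_conjTranspose_mul {κ : Type} [Fintype κ] [DecidableEq κ]
    (U : Matrix.unitaryGroup κ ℂ) : U.1ᴴ * U.1 = 1 :=
  Matrix.mem_unitaryGroup_iff'.1 U.2

theorem Step.op_mul_conjTranspose (s : Step ι m) : s.op O * (s.op O)ᴴ = 1 := by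
  cases s with
  | gate₁ w U => exact onWires_mul_conjTranspose w (unitary_mul_conjTranspose U)
  | gate₂ w U => exact onWires_mul_conjTranspose w (unitary_mul_conjTranspose U)
  | call w =>
    refine onWires_mul_conjTranspose w ?_
    rw [controlled_conjTranspose, ← controlled_mul, unitary_mul_conjTranspose, controlled_one]
  | callInv w =>
    refine onWires_mul_conjTranspose w ?_
    rw [controlled_conjTranspose, ← controlled_mul, Matrix.conjTranspose_conjTranspose,
      unitary_conjTranspose_mul, controlled_one]

theorem Circuit.op_mul_conjTranspose (c : Circuit ι m) :
    Circuit.op O c * (Circuit.op O c)ᴴ = 1 := by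
  induction c with
  | nil => simp [Circuit.op]
  | cons s c ih =>
    rw [Circuit.op, Matrix.conjTranspose_mul, Matrix.mul_assoc, ← Matrix.mul_assoc (s.op O),
      Step.op_mul_conjTranspose, Matrix.one_mul, ih]

theorem Circuit.conjTranspose_op_mul (c : Circuit ι m) :
    (Circuit.op O c)ᴴ * Circuit.op O c = 1 :=
  mul_eq_one_comm.1 (Circuit.op_mul_conjTranspose O c)

theorem Step.op_inv (s : Step ι m) : s.inv.op O = (s.op O)ᴴ := by
  cases s with
  | gate₁ w U => exact (onWires_conjTranspose w U.1).symm
  | gate₂ w U => exact (onWires_conjTranspose w U.1).symm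
  | call w => simp only [Step.inv, Step.op, onWires_conjTranspose, controlled_conjTranspose]
  | callInv w =>
    simp only [Step.inv, Step.op, onWires_conjTranspose, controlled_conjTranspose,
      Matrix.conjTranspose_conjTranspose]

theorem Circuit.op_inv (c : Circuit ι m) : Circuit.op O (Circuit.inv c) = (Circuit.op O c)ᴴ := by
  induction c with
  | nil => simp [Circuit.inv, Circuit.op]
  | cons s c ih =>
    have h : Circuit.inv (s :: c) = Circuit.inv c ++ [s.inv] := by simp [Circuit.inv]
    rw [h, Circuit.op_append, ih, Circuit.op, Circuit.op, Circuit.op, Matrix.one_mul,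
      Step.op_inv, Matrix.conjTranspose_mul]

end Circuits

end QSim

namespace QSim

set_option linter.unusedSectionVars false

/-! ### Reversible Boolean programs from two-qubit gates. -/

section ClassicalGates

variable {ι : Type} [Fintype ι] [DecidableEq ι] {m : ℕ}
  (O : Matrix.unitaryGroup (Fin m → Bool) ℂ)

/-- The `k`-th power of a square root of the `NOT` gate. -/
noncomputable def sqrtNot (k : ℕ) : Matrix Bool Bool ℂ :=
  fun s t => (1 + (if s = t then 1 else -1) * Complex.I ^ k) / 2

theorem sqrtNot_mul (k l : ℕ) : sqrtNot k * sqrtNot l = sqrtNot (k + l) := by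
  ext s t
  cases s <;> cases t <;> simp [Matrix.mul_apply, sqrtNot, pow_add] <;> ring

theorem sqrtNot_mod (k : ℕ) : sqrtNot k = sqrtNot (k % 4) := by
  funext s t
  rw [sqrtNot, sqrtNot, Complex.I_pow_eq_pow_mod]

theorem sqrtNot_zero : sqrtNot 0 = 1 := by
  ext s t
  cases s <;> cases t <;> simp [sqrtNot]

theorem sqrtNot_conjTranspose (k : ℕ) : (sqrtNot k)ᴴ = sqrtNot (3 * k) := by
  ext s t
  cases s <;> cases t <;> simp [sqrtNot, pow_mul, Complex.I_pow_three]

theorem sqrtNot_mul_conjTranspose (k : ℕ) : sqrtNot k * (sqrtNot k)ᴴ = 1 := by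
  rw [sqrtNot_conjTranspose, sqrtNot_mul, sqrtNot_mod, show (k + 3 * k) % 4 = 0 by omega,
    sqrtNot_zero]

theorem onTarget_sqrtNot_ket (t : ι) (F : (ι → Bool) → ℕ) (b : ι → Bool) (c : Bool)
    (h : F b % 4 = 2 * c.toNat) :
    onTarget t (fun b => sqrtNot (F b)) *ᵥ ket b = ket (Function.update b t (b t ^^ c)) := by
  rw [onTarget_ket]
  simp only [sqrtNot_mod (F b), h]
  cases c <;> cases hb : b t <;> simp [sqrtNot]

/-- The embedding of two distinct wires. -/
def twoWires (u t : ι) (h : u ≠ t) : Fin 2 ↪ ι :=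
  ⟨![u, t], by
    intro i j hij
    fin_cases i <;> fin_cases j <;> simp_all [eq_comm]⟩

/-- The power of the square root of `NOT` on the wire `t` with exponent controlled by `u`. -/
noncomputable def controlledSqrtNot (u t : ι) (h : u ≠ t) (f : Bool → ℕ) : Step ι m :=
  .gate₂ (twoWires u t h) ⟨onTarget 1 (fun b => sqrtNot (f (b 0))),
    onTarget_mem_unitaryGroup 1 (fun b c => by simp)
      fun b => sqrtNot_mul_conjTranspose _⟩

theorem op_controlledSqrtNot (u t : ι) (h : u ≠ t) (f : Bool → ℕ) :
    (controlledSqrtNot u t h f).op O = onTarget t (fun b => sqrtNot (f (b u))) := by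
  rw [controlledSqrtNot, Step.op, onWires_onTarget]
  rfl

/-- The circuit for `t ^= g u v`. -/
noncomputable def xorCircuit (u v t : ι) (huv : u ≠ v) (hut : u ≠ t) (hvt : v ≠ t)
    (g : Bool → Bool → Bool) : Circuit ι m :=
  let a := g false false
  -- `d` is the coefficient of `u v` in the polynomial of `g` over the field with two elements. A
  -- `NOT` is exponent `2`, and `2 u v = u + v - (u ⊕ v)`, so the quadratic term costs exponent `d`
  -- from each of `u`, `v` and exponent `3 d ≡ -d` modulo `4` from the parity `u ⊕ v`.
  let d := (a ^^ g true false ^^ g false true ^^ g true true).toNat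
  [controlledSqrtNot u t hut
      fun x => 2 * a.toNat + (2 * (a ^^ g true false).toNat + d) * x.toNat,
    controlledSqrtNot v t hvt fun x => (2 * (a ^^ g false true).toNat + d) * x.toNat,
    controlledSqrtNot u v huv fun x => 2 * x.toNat,
    controlledSqrtNot v t hvt fun x => 3 * d * x.toNat,
    controlledSqrtNot u v huv fun x => 2 * x.toNat]

theorem op_xorCircuit_ket (u v t : ι) (huv : u ≠ v) (hut : u ≠ t) (hvt : v ≠ t)
    (g : Bool → Bool → Bool) (b : ι → Bool) :
    Circuit.op O (xorCircuit u v t huv hut hvt g) *ᵥ ket b =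
      ket (Function.update b t (b t ^^ g (b u) (b v))) := by
  simp only [xorCircuit, Circuit.op, Matrix.one_mul, op_controlledSqrtNot]
  set N : Operator ι := onTarget v (fun b => sqrtNot (2 * (b u).toNat)) with hN
  have hNk : ∀ b : ι → Bool, N *ᵥ ket b = ket (Function.update b v (b v ^^ b u)) := fun b =>
    onTarget_sqrtNot_ket v _ b (b u) (by cases b u <;> rfl)
  -- Conjugation by the controlled `NOT` puts the parity `u ⊕ v` on the wire `v` temporarily.
  have hconj : ∀ k : ℕ, N * onTarget t (fun b => sqrtNot (k * (b v).toNat)) * N =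
      onTarget t (fun b => sqrtNot (k * (b v ^^ b u).toNat)) := by
    intro k
    refine ext_ket fun b => ?_
    rw [← Matrix.mulVec_mulVec, hNk, ← Matrix.mulVec_mulVec, onTarget_ket, onTarget_ket,
      Matrix.mulVec_sum]
    refine Finset.sum_congr rfl fun c _ => ?_
    rw [Matrix.mulVec_smul, hNk, Function.update_of_ne hvt.symm, Function.update_self]
    congr 2
    funext i
    by_cases hi : i = t
    · subst hi
      simp [Function.update_of_ne hvt.symm]
    · by_cases hi2 : i = v
      · subst hi2
        simp [Function.update_of_ne hi, Function.update_of_ne huv, Function.update_of_ne hut]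
      · simp [hi, hi2]
  rw [hconj, onTarget_mul, onTarget_mul]
  · simp only [sqrtNot_mul]
    refine onTarget_sqrtNot_ket t _ b _ ?_
    cases b u <;> cases b v <;> cases g false false <;> cases g true false <;>
      cases g false true <;> cases g true true <;> rfl
  · intro b c
    simp only [Function.update_of_ne hut, Function.update_of_ne hvt]
  · intro b c
    simp only [Function.update_of_ne hut, Function.update_of_ne hvt]

/-- The reversible gate `t ^= α u v ^^ β v w ^^ γ u w`. -/
structure XorGate (ι : Type) where
  u : ι
  v : ι
  w : ι
  t : ι
  α : Bool → Bool → Bool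
  β : Bool → Bool → Bool
  γ : Bool → Bool → Bool
  huv : u ≠ v
  hvw : v ≠ w
  huw : u ≠ w
  hut : u ≠ t
  hvt : v ≠ t
  hwt : w ≠ t

namespace XorGate

/-- The bit that the gate adds to its target. -/
def value (g : XorGate ι) (b : ι → Bool) : Bool :=
  (g.α (b g.u) (b g.v) ^^ g.β (b g.v) (b g.w)) ^^ g.γ (b g.u) (b g.w)

/-- The action of the gate on assignments of bits. -/
def apply (g : XorGate ι) (b : ι → Bool) : ι → Bool :=
  Function.update b g.t (b g.t ^^ g.value b)

/-- A circuit for the gate. -/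
noncomputable def circuit (g : XorGate ι) : Circuit ι m :=
  xorCircuit g.u g.v g.t g.huv g.hut g.hvt g.α ++
    (xorCircuit g.v g.w g.t g.hvw g.hvt g.hwt g.β ++
      xorCircuit g.u g.w g.t g.huw g.hut g.hwt g.γ)

theorem op_circuit_ket (g : XorGate ι) (b : ι → Bool) :
    Circuit.op O g.circuit *ᵥ ket b = ket (g.apply b) := by
  rw [circuit, Circuit.op_append, Circuit.op_append, ← Matrix.mulVec_mulVec,
    ← Matrix.mulVec_mulVec, op_xorCircuit_ket, op_xorCircuit_ket, op_xorCircuit_ket]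
  simp [apply, value, Function.update_of_ne, g.hut, g.hvt, g.hwt]

theorem value_apply (g : XorGate ι) (b : ι → Bool) : g.value (g.apply b) = g.value b := by
  simp [apply, value, Function.update_of_ne, g.hut, g.hvt, g.hwt]

theorem apply_apply (g : XorGate ι) (b : ι → Bool) : g.apply (g.apply b) = b := by
  rw [apply, value_apply, apply]
  simp

end XorGate

/-- A sequence of reversible gates, in the order of time. -/
abbrev Program (ι : Type) : Type := List (XorGate ι)

namespace Program

/-- The action of a program on assignments of bits. -/
def run : Program ι → (ι → Bool) → ι → Bool
  | [], b => b
  | g :: L, b => run L (g.apply b)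

/-- A circuit for a program. -/
noncomputable def circuit (L : Program ι) : Circuit ι m := L.flatMap XorGate.circuit

theorem run_append (L L' : Program ι) (b : ι → Bool) :
    run (L ++ L') b = run L' (run L b) := by
  induction L generalizing b with
  | nil => rfl
  | cons g L ih => exact ih (g.apply b)

theorem run_reverse_run (L : Program ι) (b : ι → Bool) : run L.reverse (run L b) = b := by
  induction L generalizing b with
  | nil => rfl
  | cons g L ih =>
    rw [List.reverse_cons, run_append, run, run, run, ih]
    exact g.apply_apply b

theorem run_run_reverse (L : Program ι) (b : ι → Bool) : run L (run L.reverse b) = b := by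
  simpa using run_reverse_run L.reverse b

theorem run_injective (L : Program ι) : Function.Injective (run L) :=
  Function.LeftInverse.injective (g := run L.reverse) (run_reverse_run L)

theorem run_of_not_target (L : Program ι) {i : ι} (h : ∀ g ∈ L, g.t ≠ i) (b : ι → Bool) :
    run L b i = b i := by
  induction L generalizing b with
  | nil => rfl
  | cons g L ih =>
    rw [run, ih fun g' hg' => h g' (List.mem_cons_of_mem _ hg'), XorGate.apply,
      Function.update_of_ne (h g List.mem_cons_self).symm]

/-- The result of a program in which a wire is written at most once, and before it is read. -/
theorem run_eq (L : Program ι) (b val : ι → Bool)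
    (hL : L.Pairwise fun g g' => g'.t ≠ g.u ∧ g'.t ≠ g.v ∧ g'.t ≠ g.w ∧ g'.t ≠ g.t)
    (h0 : ∀ i, (∀ g ∈ L, g.t ≠ i) → val i = b i)
    (h1 : ∀ g ∈ L, val g.t = (b g.t ^^ g.value val)) : run L b = val := by
  induction L generalizing b with
  | nil => exact (funext fun i => h0 i (by simp)).symm
  | cons g L ih =>
    rw [List.pairwise_cons] at hL
    -- A wire read by `g` is written neither by `g` nor later, so it already holds its final value.
    have hu : val g.u = b g.u := h0 _ fun g' hg' => by
      rcases List.mem_cons.1 hg' with rfl | hg'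
      · exact g'.hut.symm
      · exact (hL.1 g' hg').1
    have hv : val g.v = b g.v := h0 _ fun g' hg' => by
      rcases List.mem_cons.1 hg' with rfl | hg'
      · exact g'.hvt.symm
      · exact (hL.1 g' hg').2.1
    have hw : val g.w = b g.w := h0 _ fun g' hg' => by
      rcases List.mem_cons.1 hg' with rfl | hg'
      · exact g'.hwt.symm
      · exact (hL.1 g' hg').2.2.1
    have hval : g.value val = g.value b := by rw [XorGate.value, XorGate.value, hu, hv, hw]
    refine ih (g.apply b) hL.2 ?_ ?_
    · intro i hi
      by_cases hit : i = g.t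
      · subst hit
        rw [h1 g List.mem_cons_self, hval, XorGate.apply, Function.update_self]
      · rw [XorGate.apply, Function.update_of_ne hit]
        refine h0 i fun g' hg' => ?_
        rcases List.mem_cons.1 hg' with rfl | hg'
        · exact Ne.symm hit
        · exact hi g' hg'
    · intro g' hg'
      rw [h1 g' (List.mem_cons_of_mem _ hg'), XorGate.apply,
        Function.update_of_ne (hL.1 g' hg').2.2.2]

theorem op_circuit_ket (L : Program ι) (b : ι → Bool) :
    Circuit.op O (circuit L) *ᵥ ket b = ket (run L b) := by
  induction L generalizing b with
  | nil => simp [circuit, Circuit.op, run]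
  | cons g L ih =>
    rw [circuit, List.flatMap_cons, Circuit.op_append, ← Matrix.mulVec_mulVec,
      XorGate.op_circuit_ket]
    exact ih _

theorem calls_circuit (L : Program ι) : (circuit L : Circuit ι m).calls = 0 := by
  induction L with
  | nil => rfl
  | cons g L ih =>
    rw [circuit, List.flatMap_cons, Circuit.calls_append]
    exact (Nat.add_eq_zero_iff.2 ⟨rfl, ih⟩)

theorem gates_circuit (L : Program ι) : (circuit L : Circuit ι m).gates = 15 * L.length := by
  induction L with
  | nil => rfl
  | cons g L ih =>
    rw [circuit, List.flatMap_cons, Circuit.gates_append, List.length_cons]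
    change 15 + (circuit L : Circuit ι m).gates = _
    rw [ih]
    ring

end Program

end ClassicalGates

end QSim

namespace QSim

/-! ### Modular addition and subtraction by ripple carries. -/

section Arithmetic

/-- The number with the `m` lowest bits given by `a`. -/
def bitValue (a : ℕ → Bool) (m : ℕ) : ℕ := ∑ i ∈ Finset.range m, (a i).toNat * 2 ^ i

/-- The carries of the addition of two numbers given by their bits. -/
def carry (a b : ℕ → Bool) (c : Bool) : ℕ → Bool
  | 0 => c
  | i + 1 => ((a i && b i) ^^ (b i && carry a b c i)) ^^ (a i && carry a b c i)

/-- The bits of the sum of two numbers given by their bits. -/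
def sumBit (a b : ℕ → Bool) (c : Bool) (i : ℕ) : Bool := (a i ^^ b i) ^^ carry a b c i

theorem bitValue_succ (a : ℕ → Bool) (m : ℕ) :
    bitValue a (m + 1) = bitValue a m + (a m).toNat * 2 ^ m :=
  Finset.sum_range_succ _ _

theorem bitValue_sumBit (a b : ℕ → Bool) (c : Bool) (m : ℕ) :
    bitValue (sumBit a b c) m + (carry a b c m).toNat * 2 ^ m =
      bitValue a m + bitValue b m + c.toNat := by
  induction m with
  | zero => simp [bitValue, carry]
  | succ m ih =>
    rw [bitValue_succ, bitValue_succ, bitValue_succ, pow_succ, carry, sumBit]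
    cases a m <;> cases b m <;> cases h : carry a b c m <;> simp_all <;> omega

theorem bitValue_lt (a : ℕ → Bool) (m : ℕ) : bitValue a m < 2 ^ m := by
  induction m with
  | zero => simp [bitValue]
  | succ m ih =>
    rw [bitValue_succ, pow_succ]
    cases a m <;> simp <;> omega

theorem bitValue_not (a : ℕ → Bool) (m : ℕ) :
    bitValue (fun i => !a i) m + bitValue a m + 1 = 2 ^ m := by
  induction m with
  | zero => simp [bitValue]
  | succ m ih =>
    rw [bitValue_succ, bitValue_succ, pow_succ]
    cases a m <;> simp <;> omega

theorem bitValue_testBit (j m : ℕ) : bitValue j.testBit m = j % 2 ^ m := by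
  induction m with
  | zero => simp [bitValue, Nat.mod_one]
  | succ m ih => rw [bitValue_succ, ih, Nat.mod_pow_succ, Nat.toNat_testBit, mul_comm]

theorem eq_of_bitValue_eq {a b : ℕ → Bool} {m : ℕ} (h : bitValue a m = bitValue b m) :
    ∀ i < m, a i = b i := by
  induction m with
  | zero => simp
  | succ m ih =>
    rw [bitValue_succ, bitValue_succ] at h
    have h1 := bitValue_lt a m
    have h2 := bitValue_lt b m
    have h3 : a m = b m := by
      cases ha : a m <;> cases hb : b m <;> simp_all <;> omega
    intro i hi
    rcases Nat.lt_succ_iff_lt_or_eq.1 hi with hi | rfl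
    · exact ih (by rw [h3] at h; omega) i hi
    · exact h3

/-- The bits of `l + z` or, if `p`, of `l - z` modulo a power of two. -/
def addBit (p : Bool) (l z : ℕ → Bool) (i : ℕ) : Bool := sumBit l (fun i => p ^^ z i) p i

/-- The carries of `addBit`. -/
def addCarry (p : Bool) (l z : ℕ → Bool) (i : ℕ) : Bool := carry l (fun i => p ^^ z i) p i

/-- The bits of the result of `addBit`, corrected by subtracting or adding `n`. -/
def fixBit (n : ℕ) (p : Bool) (l z : ℕ → Bool) (i : ℕ) : Bool :=
  sumBit (addBit p l z) (fun i => n.testBit i ^^ !p) (!p) i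

/-- The carries of `fixBit`. -/
def fixCarry (n : ℕ) (p : Bool) (l z : ℕ → Bool) (i : ℕ) : Bool :=
  carry (addBit p l z) (fun i => n.testBit i ^^ !p) (!p) i

/-- Whether the correction is needed. -/
def needsFix (n m : ℕ) (p : Bool) (l z : ℕ → Bool) : Bool :=
  (p ^^ addCarry p l z m) ^^ (!p && fixCarry n p l z m)

/-- The bits of `l + z` or, if `p`, of `l - z` modulo `n`. -/
def modBit (n m : ℕ) (p : Bool) (l z : ℕ → Bool) (i : ℕ) : Bool :=
  (!needsFix n m p l z && addBit p l z i) ^^ (needsFix n m p l z && fixBit n p l z i)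

/-- Subtraction adds the complement with carry-in `1`; its carry-out means "no borrow". For `a - j`
the correction `+ n` is needed exactly on a borrow. For `a + j` with `n < 2^m` the correction `- n`
is needed if the sum overflows or if it is at least `n` as an `m`-bit number; the two carries are
never both `1`, so their exclusive or decides. -/
theorem modBit_eq_testBit {n m : ℕ} (hn : n ≤ 2 ^ m) {a j : ℕ} (ha : a < n) (hj : j < n)
    (p : Bool) : ∀ i < m, modBit n m p a.testBit j.testBit i =
      ((if p then n - j + a else a + j) % n).testBit i := by
  have hA : bitValue (fun i => a.testBit i) m = _ := bitValue_testBit a m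
  have hJ : bitValue (fun i => j.testBit i) m = _ := bitValue_testBit j m
  have hN : bitValue (fun i => n.testBit i) m = _ := bitValue_testBit n m
  rw [Nat.mod_eq_of_lt (ha.trans_le hn)] at hA
  rw [Nat.mod_eq_of_lt (hj.trans_le hn)] at hJ
  -- For `n = 2^m` the lowest `m` bits of `n` vanish and the correction changes nothing, so either
  -- choice is right.
  have hnN : n % 2 ^ m = if n = 2 ^ m then 0 else n := by
    split_ifs with h
    · rw [h, Nat.mod_self]
    · exact Nat.mod_eq_of_lt (lt_of_le_of_ne hn h)
  rw [hnN] at hN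
  have h1 := bitValue_sumBit (fun i => a.testBit i) (fun i => p ^^ j.testBit i) p m
  have h2 := bitValue_sumBit (addBit p a.testBit j.testBit) (fun i => n.testBit i ^^ !p) (!p) m
  change bitValue (addBit p a.testBit j.testBit) m +
    (addCarry p a.testBit j.testBit m).toNat * 2 ^ m = _ at h1
  change bitValue (fixBit n p a.testBit j.testBit) m +
    (fixCarry n p a.testBit j.testBit m).toNat * 2 ^ m = _ at h2
  have h3 := bitValue_lt (addBit p a.testBit j.testBit) m
  have h4 := bitValue_lt (fixBit n p a.testBit j.testBit) m
  refine eq_of_bitValue_eq ?_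
  rw [bitValue_testBit, Nat.mod_eq_of_lt ((Nat.mod_lt _ (by omega)).trans_le hn)]
  have hmod : ∀ x r, (x = r ∧ r < n) ∨ (x = r + n ∧ r < n) → r = x % n := by
    rintro x r (⟨rfl, h⟩ | ⟨rfl, h⟩)
    · exact (Nat.mod_eq_of_lt h).symm
    · rw [Nat.add_mod_right, Nat.mod_eq_of_lt h]
  have hsel : bitValue (modBit n m p a.testBit j.testBit) m =
      if needsFix n m p a.testBit j.testBit then bitValue (fixBit n p a.testBit j.testBit) m
      else bitValue (addBit p a.testBit j.testBit) m := by
    cases h : needsFix n m p a.testBit j.testBit <;>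
      simp [bitValue, modBit, h]
  rw [hsel]
  apply hmod
  clear hsel hmod
  have hJn := bitValue_not (fun i => j.testBit i) m
  have hNn := bitValue_not (fun i => n.testBit i) m
  have hnp : n < 2 ^ m ∨ n = 2 ^ m := lt_or_eq_of_le hn
  cases p
  · simp only [Bool.false_xor, Bool.not_false, Bool.xor_true, Bool.toNat_false,
      Bool.toNat_true] at h1 h2
    cases hc1 : addCarry false a.testBit j.testBit m <;>
      cases hc3 : fixCarry n false a.testBit j.testBit m <;>
      simp only [needsFix, hc1, hc3, Bool.toNat_false, Bool.toNat_true,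
        Bool.not_false, Bool.true_and, Bool.xor_true, Bool.not_true, if_true, if_false,
        Bool.xor_false, Bool.false_eq_true] at h1 h2 ⊢ <;>
      split_ifs at hN <;> omega
  · simp only [Bool.true_xor, Bool.not_true, Bool.xor_false, Bool.toNat_false,
      Bool.toNat_true] at h1 h2
    cases hc1 : addCarry true a.testBit j.testBit m <;>
      cases hc3 : fixCarry n true a.testBit j.testBit m <;>
      simp only [needsFix, hc1, hc3, Bool.toNat_false, Bool.toNat_true, Bool.true_xor, Bool.false_and, Bool.not_true, if_true, if_false,
        Bool.xor_false, Bool.false_eq_true] at h1 h2 ⊢ <;>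
      split_ifs at hN <;> omega

/-- The disjunctions of the initial segments of a sequence of bits. -/
def orChain (z : ℕ → Bool) : ℕ → Bool
  | 0 => false
  | i + 1 => orChain z i || z i

theorem orChain_eq_false_iff (z : ℕ → Bool) (m : ℕ) :
    orChain z m = false ↔ ∀ i < m, z i = false := by
  induction m with
  | zero => simp [orChain]
  | succ m ih =>
    rw [orChain, Bool.or_eq_false_iff, ih]
    constructor
    · rintro ⟨h1, h2⟩ i hi
      rcases Nat.lt_succ_iff_lt_or_eq.1 hi with hi | rfl
      · exact h1 i hi
      · exact h2
    · intro h
      exact ⟨fun i hi => h i (by omega), h m (by omega)⟩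

end Arithmetic

/-! ### Wire layout and the program that computes the modular sum. -/

section Registers

/-- The ancilla wires: an index register for the oracle, a register for the result of the
modular addition, the control qubit, a flag, and work qubits. -/
abbrev Anc (m : ℕ) : Type := (Fin m ⊕ Fin m) ⊕ (Bool ⊕ (Fin (m + 1) × Fin 7))

/-- All wires. -/
abbrev Reg (m : ℕ) : Type := Unit ⊕ Fin m ⊕ Anc m

instance decidableEqAnc (m : ℕ) : DecidableEq (Anc m) := inferInstance

instance decidableEqReg (m : ℕ) : DecidableEq (Reg m) :=
  have : DecidableEq (Fin m ⊕ Anc m) := inferInstance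
  inferInstance

variable {m : ℕ}

/-- The qubit of the dilation. -/
abbrev wireP : Reg m := .inl ()
/-- The index register. -/
abbrev wireL (i : Fin m) : Reg m := .inr (.inl i)
/-- The register on which the oracle acts. -/
abbrev wireZ (i : Fin m) : Reg m := .inr (.inr (.inl (.inl i)))
/-- The register for the result of the modular addition. -/
abbrev wireY (i : Fin m) : Reg m := .inr (.inr (.inl (.inr i)))
/-- The control qubit. -/
abbrev wireQ : Reg m := .inr (.inr (.inr (.inl false)))
/-- The flag. -/
abbrev wireF : Reg m := .inr (.inr (.inr (.inl true)))
/-- The work qubits. -/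
abbrev wireW (i : Fin (m + 1)) (k : Fin 7) : Reg m := .inr (.inr (.inr (.inr (i, k))))

/-- A bit string as a function on the natural numbers. -/
def ext (z : Fin m → Bool) (i : ℕ) : Bool := if h : i < m then z ⟨i, h⟩ else false

@[simp] theorem ext_val (z : Fin m → Bool) (i : Fin m) : ext z i = z i := by simp [ext]

/-- The assignment of bits with all work qubits `0`. -/
def clean (q p : Bool) (l z y : Fin m → Bool) : Reg m → Bool
  | .inl _ => p
  | .inr (.inl i) => l i
  | .inr (.inr (.inl (.inl i))) => z i
  | .inr (.inr (.inl (.inr i))) => y i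
  | .inr (.inr (.inr (.inl false))) => q
  | .inr (.inr (.inr (.inl true))) => false
  | .inr (.inr (.inr (.inr _))) => false

/-- The content of the work qubits at position `i` after the computation. -/
def workBit (n : ℕ) (p : Bool) (l z : Fin m → Bool) (i : ℕ) : Fin 7 → Bool :=
  ![orChain (ext z) i, addCarry p (ext l) (ext z) i, fixCarry n p (ext l) (ext z) i,
    decide (i < m) && (p ^^ ext z i), decide (i < m) && addBit p (ext l) (ext z) i,
    decide (i < m) && (n.testBit i ^^ !p), decide (i < m) && fixBit n p (ext l) (ext z) i]

/-- The assignment of bits after the computation. -/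
def computed (n : ℕ) (q p : Bool) (l z y : Fin m → Bool) : Reg m → Bool
  | .inl _ => p
  | .inr (.inl i) => l i
  | .inr (.inr (.inl (.inl i))) => z i
  | .inr (.inr (.inl (.inr i))) => y i
  | .inr (.inr (.inr (.inl false))) => q
  | .inr (.inr (.inr (.inl true))) => needsFix n m p (ext l) (ext z)
  | .inr (.inr (.inr (.inr (i, k)))) => workBit n p l z i k

/-- The exclusive or of three bits, as a gate. -/
abbrev xorGate {ι : Type} (u v w t : ι) (huv : u ≠ v) (hvw : v ≠ w) (huw : u ≠ w) (hut : u ≠ t)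
    (hvt : v ≠ t) (hwt : w ≠ t) : XorGate ι :=
  ⟨u, v, w, t, fun x y => x ^^ y, fun _ _ => false, fun _ y => y, huv, hvw, huw, hut, hvt, hwt⟩

/-- The majority of three bits, as a gate. -/
abbrev majGate {ι : Type} (u v w t : ι) (huv : u ≠ v) (hvw : v ≠ w) (huw : u ≠ w) (hut : u ≠ t)
    (hvt : v ≠ t) (hwt : w ≠ t) : XorGate ι :=
  ⟨u, v, w, t, fun x y => x && y, fun x y => x && y, fun x y => x && y,
    huv, hvw, huw, hut, hvt, hwt⟩

/-- A gate that depends on two bits only. -/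
abbrev binGate {ι : Type} (α : Bool → Bool → Bool) (u v w t : ι) (huv : u ≠ v) (hvw : v ≠ w)
    (huw : u ≠ w) (hut : u ≠ t) (hvt : v ≠ t) (hwt : w ≠ t) : XorGate ι :=
  ⟨u, v, w, t, α, fun _ _ => false, fun _ _ => false, huv, hvw, huw, hut, hvt, hwt⟩

theorem castSucc_ne_succ' (i : Fin m) : i.castSucc ≠ i.succ := by
  simp [Fin.ext_iff]

/-- The part of the computation at one position. -/
def blockProgram (n : ℕ) (i : Fin m) : Program (Reg m) :=
  [binGate (fun x y => x ^^ y) wireP (wireZ i) (wireL i) (wireW i.castSucc 3)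
      (by simp) (by simp) (by simp) (by simp) (by simp) (by simp),
    xorGate (wireL i) (wireW i.castSucc 3) (wireW i.castSucc 1) (wireW i.castSucc 4)
      (by simp) (by simp) (by simp) (by simp) (by simp) (by simp),
    binGate (fun x _ => n.testBit i ^^ !x) wireP (wireZ i) (wireL i) (wireW i.castSucc 5)
      (by simp) (by simp) (by simp) (by simp) (by simp) (by simp),
    xorGate (wireW i.castSucc 4) (wireW i.castSucc 5) (wireW i.castSucc 2) (wireW i.castSucc 6)
      (by simp) (by simp) (by simp) (by simp) (by simp) (by simp),
    binGate (fun x y => x || y) (wireW i.castSucc 0) (wireZ i) wireP (wireW i.succ 0)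
      (by simp) (by simp) (by simp) (by simp [castSucc_ne_succ']) (by simp) (by simp),
    majGate (wireL i) (wireW i.castSucc 3) (wireW i.castSucc 1) (wireW i.succ 1)
      (by simp) (by simp) (by simp) (by simp) (by simp) (by simp [castSucc_ne_succ']),
    majGate (wireW i.castSucc 4) (wireW i.castSucc 5) (wireW i.castSucc 2) (wireW i.succ 2)
      (by simp) (by simp) (by simp) (by simp) (by simp) (by simp [castSucc_ne_succ'])]

/-- The computation of the modular sum and of the disjunction. -/
def computeProgram (n m : ℕ) : Program (Reg m) :=
  [binGate (fun x _ => x) wireP wireQ (wireW 0 0) (wireW 0 1)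
      (by simp) (by simp) (by simp) (by simp) (by simp) (by simp),
    binGate (fun x _ => !x) wireP wireQ (wireW 0 0) (wireW 0 2)
      (by simp) (by simp) (by simp) (by simp) (by simp) (by simp)] ++
  ((List.finRange m).flatMap (blockProgram n) ++
  [⟨wireP, wireW (Fin.last m) 1, wireW (Fin.last m) 2, wireF, fun x y => x ^^ y,
    fun _ _ => false, fun x y => !x && y,
    by simp, by simp, by simp, by simp, by simp, by simp⟩])

/-- A rank function for the order in which the wires are written. -/
def wireRank : Reg m → ℕ
  | .inr (.inr (.inr (.inl true))) => 7 * m + 8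
  | .inr (.inr (.inr (.inr (i, k)))) => 7 * i + k + 1
  | _ => 0

/-- The rank acts as a time of writing: targets increase along the program and sources lie below
their target, so a later target cannot be an earlier source or target. This supplies the order
condition of `Program.run_eq`. -/
theorem pairwise_of_rank {ι : Type} (rank : ι → ℕ) {L : Program ι}
    (h : L.Pairwise fun g g' => rank g.t < rank g'.t)
    (h' : ∀ g ∈ L, rank g.u < rank g.t ∧ rank g.v < rank g.t ∧ rank g.w < rank g.t) :
    L.Pairwise fun g g' => g'.t ≠ g.u ∧ g'.t ≠ g.v ∧ g'.t ≠ g.w ∧ g'.t ≠ g.t := by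
  refine (List.Pairwise.and_mem.1 h).imp fun {g g'} hgg => ?_
  obtain ⟨hg, -, hlt⟩ := hgg
  obtain ⟨h1, h2, h3⟩ := h' g hg
  refine ⟨?_, ?_, ?_, ?_⟩ <;> intro h4 <;> rw [h4] at hlt <;> omega

/-- A block writes columns `3` to `6` at position `i` and the carries in columns `0` to `2` at
position `i + 1`; hence consecutive blocks occupy disjoint increasing intervals of ranks. -/
theorem rank_blockProgram (n : ℕ) (i : Fin m) : ∀ g ∈ blockProgram n i,
    7 * (i : ℕ) + 4 ≤ wireRank g.t ∧ wireRank g.t ≤ 7 * (i : ℕ) + 10 := by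
  simp only [blockProgram, List.forall_mem_cons, wireRank]
  simp
  omega

theorem rank_source_blockProgram (n : ℕ) (i : Fin m) : ∀ g ∈ blockProgram n i,
    wireRank g.u < wireRank g.t ∧ wireRank g.v < wireRank g.t ∧
      wireRank g.w < wireRank g.t := by
  simp only [blockProgram, List.forall_mem_cons, wireRank]
  simp
  omega

theorem computeProgram_pairwise (n m : ℕ) : (computeProgram n m).Pairwise fun g g' =>
    g'.t ≠ g.u ∧ g'.t ≠ g.v ∧ g'.t ≠ g.w ∧ g'.t ≠ g.t := by
  refine pairwise_of_rank wireRank ?_ ?_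
  · rw [computeProgram, List.pairwise_append, List.pairwise_append, List.pairwise_flatMap]
    refine ⟨by simp [wireRank], ⟨⟨fun i _ => ?_, ?_⟩, by simp, ?_⟩, ?_⟩
    · simp [blockProgram, wireRank]
      omega
    · refine (List.pairwise_lt_finRange m).imp fun {i j} hij g hg g' hg' => ?_
      have : (i : ℕ) < j := hij
      have h1 := (rank_blockProgram n i g hg).2
      have h2 := (rank_blockProgram n j g' hg').1
      omega
    · intro g hg g' hg'
      obtain ⟨i, -, hg⟩ := List.mem_flatMap.1 hg
      rw [List.mem_singleton] at hg'
      subst hg'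
      have h1 := (rank_blockProgram n i g hg).2
      have := i.2
      simp only [wireRank] at h1 ⊢
      omega
    · intro g hg g' hg'
      have h1 : wireRank g.t ≤ 3 := by
        revert g
        simp [wireRank]
      rcases List.mem_append.1 hg' with hg' | hg'
      · obtain ⟨i, -, hg'⟩ := List.mem_flatMap.1 hg'
        have h2 := (rank_blockProgram n i g' hg').1
        omega
      · rw [List.mem_singleton] at hg'
        subst hg'
        refine lt_of_le_of_lt h1 ?_
        simp [wireRank]
  · simp only [computeProgram, List.forall_mem_append, List.forall_mem_cons, List.mem_flatMap,
        forall_exists_index, and_imp]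
    exact ⟨⟨by simp [wireRank], by simp [wireRank], by simp⟩,
      fun g i _ hg => rank_source_blockProgram n i g hg, by simp [wireRank], by simp⟩

theorem run_computeProgram (n : ℕ) (q p : Bool) (l z y : Fin m → Bool) :
    (computeProgram n m).run (clean q p l z y) = computed n q p l z y := by
  refine Program.run_eq _ _ _ (computeProgram_pairwise n m) ?_ ?_
  · intro w hw
    simp only [computeProgram, List.forall_mem_append, List.forall_mem_cons, List.mem_flatMap,
      forall_exists_index, and_imp] at hw
    obtain ⟨⟨h0, h1, -⟩, h2, h3, -⟩ := hw
    have h4 : ∀ i : Fin m, ∀ g ∈ blockProgram n i, g.t ≠ w := fun i g hg =>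
      h2 g i (List.mem_finRange i) hg
    simp only [blockProgram, List.forall_mem_cons] at h4
    rcases w with _ | i | (i | i) | (_ | _) | ⟨i, k⟩
    · rfl
    · rfl
    · rfl
    · rfl
    · rfl
    · simp at h3
    · have hk : ∀ k : Fin 7, k = 0 ∨ k = 1 ∨ k = 2 ∨ (k = 3 ∨ k = 4 ∨ k = 5 ∨ k = 6) := by
        decide
      rcases hk k with rfl | rfl | rfl | hk
      · cases i using Fin.cases with
        | zero => rfl
        | succ i => simpa using h4 i
      · exfalso
        cases i using Fin.cases with
        | zero => simp at h0
        | succ i => simpa using h4 i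
      · exfalso
        cases i using Fin.cases with
        | zero => simp at h1
        | succ i => simpa using h4 i
      -- The extra position `m` only receives the last disjunction and carries. Its columns `3` to
      -- `6` stay `0`, which is why `workBit` has the guard `decide (i < m)`.
      · cases i using Fin.lastCases with
        | last => rcases hk with rfl | rfl | rfl | rfl <;> simp [computed, clean, workBit]
        | cast i => rcases hk with rfl | rfl | rfl | rfl <;> simpa using h4 i
  · simp only [computeProgram, List.forall_mem_append, List.forall_mem_cons, List.mem_flatMap,
        forall_exists_index, and_imp]
    refine ⟨⟨?_, ?_, by simp⟩, ?_, ?_, by simp⟩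
    · simp [computed, clean, workBit, XorGate.value, addCarry, carry]
    · simp [computed, clean, workBit, XorGate.value, fixCarry, carry]
    · intro g i _
      revert g
      simp only [blockProgram, List.forall_mem_cons]
      refine ⟨?_, ?_, ?_, ?_, ?_, ?_, ?_, by simp⟩
      · simp [computed, clean, workBit, XorGate.value]
      · simp [computed, clean, workBit, XorGate.value, addBit, sumBit, addCarry]
      · simp [computed, clean, workBit, XorGate.value]
      · simp [computed, clean, workBit, XorGate.value, fixBit, sumBit, fixCarry]
      · simp [computed, clean, workBit, XorGate.value, orChain]
      · simp [computed, clean, workBit, XorGate.value, addCarry, carry]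
      · simp [computed, clean, workBit, XorGate.value, fixCarry, carry]
    · simp [computed, clean, workBit, XorGate.value, needsFix]

end Registers

end QSim

namespace QSim

/-! ### The controlled in-place modular shift. -/

section Shift

variable {m : ℕ}

/-- The bits of the modular sum or difference of two bit strings. -/
def modSum (n : ℕ) (p : Bool) (l z : Fin m → Bool) (i : Fin m) : Bool :=
  modBit n m p (ext l) (ext z) i

/-- Addition of the computed modular sum to the result register. -/
def copyProgram (m : ℕ) : Program (Reg m) :=
  (List.finRange m).map fun i =>
    ⟨wireF, wireW i.castSucc 4, wireW i.castSucc 6, wireY i, fun x y => !x && y,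
      fun _ _ => false, fun x y => x && y,
      by simp, by simp, by simp, by simp, by simp, by simp⟩

/-- Addition of the index register to the result register. -/
def addIndexProgram (m : ℕ) : Program (Reg m) :=
  (List.finRange m).map fun i =>
    binGate (fun x _ => x) (wireL i) wireP wireQ (wireY i)
      (by simp) (by simp) (by simp) (by simp) (by simp) (by simp)

/-- Controlled addition of the result register to the index register, and a controlled flip of
the dilation qubit. -/
def updateProgram (m : ℕ) : Program (Reg m) :=
  ((List.finRange m).map fun i =>
    binGate (fun x y => x && y) wireQ (wireY i) wireF (wireL i)
      (by simp) (by simp) (by simp) (by simp) (by simp) (by simp)) ++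
  [binGate (fun x _ => x) wireQ wireF (wireW 0 0) wireP
      (by simp) (by simp) (by simp) (by simp) (by simp) (by simp)]

theorem run_copyProgram (n : ℕ) (q p : Bool) (l z y : Fin m → Bool) :
    (copyProgram m).run (computed n q p l z y) =
      computed n q p l z (fun i => y i ^^ modSum n p l z i) := by
  refine Program.run_eq _ _ _ ?_ ?_ ?_
  · rw [copyProgram, List.pairwise_map]
    exact (List.pairwise_lt_finRange m).imp fun {i j} hij => by simp [hij.ne']
  · intro w hw
    rcases w with _ | i | (i | i) | (_ | _) | ⟨i, k⟩ <;> try rfl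
    simp [copyProgram] at hw
  · simp [copyProgram, computed, XorGate.value, modSum, modBit, workBit]

theorem run_addIndexProgram (q p : Bool) (l z y : Fin m → Bool) :
    (addIndexProgram m).run (clean q p l z y) = clean q p l z (fun i => y i ^^ l i) := by
  refine Program.run_eq _ _ _ ?_ ?_ ?_
  · rw [addIndexProgram, List.pairwise_map]
    exact (List.pairwise_lt_finRange m).imp fun {i j} hij => by simp [hij.ne']
  · intro w hw
    rcases w with _ | i | (i | i) | (_ | _) | ⟨i, k⟩ <;> try rfl
    simp [addIndexProgram] at hw
  · simp [addIndexProgram, clean, XorGate.value]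

theorem updateProgram_pairwise (m : ℕ) : (updateProgram m).Pairwise fun g g' =>
    g'.t ≠ g.u ∧ g'.t ≠ g.v ∧ g'.t ≠ g.w ∧ g'.t ≠ g.t := by
  rw [updateProgram, List.pairwise_append, List.pairwise_map]
  refine ⟨(List.pairwise_lt_finRange m).imp fun {i j} hij => by simp [hij.ne'], by simp, ?_⟩
  simp

theorem run_updateProgram (p : Bool) (l z y : Fin m → Bool) :
    (updateProgram m).run (clean true p l z y) = clean true (!p) (fun i => l i ^^ y i) z y := by
  refine Program.run_eq _ _ _ (updateProgram_pairwise m) ?_ ?_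
  · intro w hw
    rcases w with _ | i | (i | i) | (_ | _) | ⟨i, k⟩ <;> try rfl
    · simp [updateProgram, or_imp, forall_and] at hw
    · simp [updateProgram, or_imp, forall_and] at hw
  · simp [updateProgram, or_imp, forall_and, clean, XorGate.value]

theorem run_updateProgram_of_not (b : Reg m → Bool) (hb : b wireQ = false) :
    (updateProgram m).run b = b := by
  refine Program.run_eq _ _ _ (updateProgram_pairwise m) (fun _ _ => rfl) ?_
  simp [updateProgram, or_imp, forall_and, XorGate.value, hb]

/-- The computation of the sum of the index register and the modular sum in the result
register. -/
def prepareProgram (n m : ℕ) : Program (Reg m) :=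
  computeProgram n m ++ (copyProgram m ++ ((computeProgram n m).reverse ++ addIndexProgram m))

theorem run_prepareProgram (n : ℕ) (q p : Bool) (l z y : Fin m → Bool) :
    (prepareProgram n m).run (clean q p l z y) =
      clean q p l z (fun i => (y i ^^ modSum n p l z i) ^^ l i) := by
  rw [prepareProgram, Program.run_append, Program.run_append, Program.run_append,
    run_computeProgram, run_copyProgram, ← run_computeProgram, Program.run_reverse_run,
    run_addIndexProgram]

theorem computeProgram_target (n : ℕ) : ∀ g ∈ computeProgram n m, g.t ≠ wireQ := by
  simp only [computeProgram, List.forall_mem_append, List.forall_mem_cons, List.mem_flatMap,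
    forall_exists_index, and_imp]
  refine ⟨⟨by simp, by simp, by simp⟩, ?_, by simp, by simp⟩
  intro g i _
  revert g
  simp [blockProgram]

theorem prepareProgram_target (n : ℕ) : ∀ g ∈ prepareProgram n m, g.t ≠ wireQ := by
  simp only [prepareProgram, List.forall_mem_append, List.mem_reverse]
  refine ⟨computeProgram_target n, ?_, computeProgram_target n, ?_⟩
  · simp [copyProgram]
  · simp [addIndexProgram]

/-- The controlled modular shift of the index register, which also flips the dilation qubit. -/
def shiftProgram (n m : ℕ) : Program (Reg m) :=
  prepareProgram n m ++ (updateProgram m ++ (prepareProgram n m).reverse)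

/-- Only the update needs the control: without it the preparation and its inverse cancel, on
arbitrary, also unclean, assignments. -/
theorem run_shiftProgram_of_not (n : ℕ) (b : Reg m → Bool) (hb : b wireQ = false) :
    (shiftProgram n m).run b = b := by
  rw [shiftProgram, Program.run_append, Program.run_append, run_updateProgram_of_not,
    Program.run_reverse_run]
  rw [Program.run_of_not_target _ (prepareProgram_target n), hb]

/-- With `l'` the shifted index, the preparation stores `l ⊕ l'`, and adding this to `l` gives `l'`.
By `h` the opposite shift takes `l'` back to `l`, so preparing from the new state would store the
same `l' ⊕ l`; the reversed preparation therefore clears the result register. -/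
theorem run_shiftProgram (n : ℕ) (p : Bool) (l z : Fin m → Bool)
    (h : modSum n (!p) (modSum n p l z) z = l) :
    (shiftProgram n m).run (clean true p l z fun _ => false) =
      clean true (!p) (modSum n p l z) z fun _ => false := by
  rw [shiftProgram, Program.run_append, Program.run_append, run_prepareProgram,
    run_updateProgram]
  refine (Program.run_injective (prepareProgram n m)) ?_
  rw [Program.run_run_reverse, run_prepareProgram, h]
  have h1 : (fun i => l i ^^ ((false ^^ modSum n p l z i) ^^ l i)) = modSum n p l z := by
    funext i
    cases l i <;> cases modSum n p l z i <;> rfl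
  have h2 : (fun i => (false ^^ l i) ^^ modSum n p l z i) =
      fun i => (false ^^ modSum n p l z i) ^^ l i := by
    funext i
    cases l i <;> cases modSum n p l z i <;> rfl
  rw [h1, h2]

theorem length_computeProgram (n m : ℕ) : (computeProgram n m).length = 7 * m + 3 := by
  simp [computeProgram, blockProgram, List.length_flatMap]
  omega

theorem length_shiftProgram (n m : ℕ) : (shiftProgram n m).length = 33 * m + 13 := by
  simp [shiftProgram, prepareProgram, updateProgram, copyProgram, addIndexProgram,
    length_computeProgram]
  ring

/-- The index that is the result of the shift of `a` by `j`. -/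
def shiftIndex {n : ℕ} (p : Bool) (a j : Fin n) : Fin n := if p then a - j else a + j

theorem shiftIndex_shiftIndex {n : ℕ} (p : Bool) (a j : Fin n) :
    shiftIndex (!p) (shiftIndex p a j) j = a := by
  have : NeZero n := ⟨by rintro rfl; exact a.elim0⟩
  cases p <;> simp [shiftIndex]

theorem ext_bits {n : ℕ} (a : Fin n) : ext (bits a) = (a : ℕ).testBit := by
  funext i
  rw [ext]
  split_ifs with h
  · rfl
  · refine (Nat.testBit_lt_two_pow ?_).symm
    calc (a : ℕ) < n := a.2
      _ ≤ 2 ^ numQubits n := Nat.le_pow_clog (by norm_num) n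
      _ ≤ 2 ^ i := Nat.pow_le_pow_right (by norm_num) (by omega)

theorem modSum_bits {n : ℕ} (p : Bool) (a j : Fin n) :
    modSum n p (bits a) (bits j) = bits (shiftIndex p a j) := by
  funext i
  rw [modSum, ext_bits, ext_bits,
    modBit_eq_testBit (m := numQubits n) (Nat.le_pow_clog (by norm_num) n) a.2 j.2 p i i.2, bits, shiftIndex]
  cases p
  · simp [Fin.val_add]
  · simp [Fin.sub_def]

theorem run_shiftProgram_bits {n : ℕ} (p : Bool) (a j : Fin n) :
    (shiftProgram n (numQubits n)).run (clean true p (bits a) (bits j) fun _ => false) =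
      clean true (!p) (bits (shiftIndex p a j)) (bits j) fun _ => false := by
  rw [run_shiftProgram, modSum_bits]
  rw [modSum_bits, modSum_bits, shiftIndex_shiftIndex]

end Shift

/-! ### The controlled walk operator as a circuit. -/

section WalkCircuit

variable {m : ℕ} (O : Matrix.unitaryGroup (Fin m → Bool) ℂ)

section Sign

variable {ι : Type} [Fintype ι] [DecidableEq ι]

/-- The change of sign if both wires are `1`. -/
noncomputable def controlledSign (u t : ι) (h : u ≠ t) : Step ι m :=
  .gate₂ (twoWires u t h)
    ⟨onTarget 1 (fun b => Matrix.diagonal fun s => if b 0 && s then -1 else 1),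
      onTarget_mem_unitaryGroup 1 (fun b c => by simp) fun b => by
        rw [Matrix.diagonal_conjTranspose, Matrix.diagonal_mul_diagonal, ← Matrix.diagonal_one]
        congr 1
        funext s
        simp only [Pi.star_apply]
        split_ifs <;> simp⟩

theorem op_controlledSign_ket (u t : ι) (h : u ≠ t) (b : ι → Bool) :
    (controlledSign u t h).op O *ᵥ ket b = (if b u && b t then (-1 : ℂ) else 1) • ket b := by
  rw [controlledSign, Step.op, onWires_onTarget]
  change onTarget t _ *ᵥ ket b = _
  rw [onTarget_ket, Finset.sum_eq_single (b t)]
  · rw [Matrix.diagonal_apply_eq, Function.update_eq_self]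
    rfl
  · intro c _ hc
    rw [Matrix.diagonal_apply_ne _ hc, zero_smul]
  · simp

end Sign

/-- The controlled reflection about the state `|0…0⟩` of the register of the oracle. -/
noncomputable def reflectionCircuit (n m : ℕ) : Circuit (Reg m) m :=
  (computeProgram n m).circuit ++
    (controlledSign wireQ (wireW (Fin.last m) 0) (by simp) ::
      Program.circuit (computeProgram n m).reverse)

theorem op_reflectionCircuit (n : ℕ) (b : Reg m → Bool) :
    Circuit.op O (reflectionCircuit n m) *ᵥ ket b =
      (if b wireQ && (computeProgram n m).run b (wireW (Fin.last m) 0)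
        then (-1 : ℂ) else 1) • ket b := by
  rw [reflectionCircuit, Circuit.op_append, ← Matrix.mulVec_mulVec, Program.op_circuit_ket,
    Circuit.op, ← Matrix.mulVec_mulVec, op_controlledSign_ket, Matrix.mulVec_smul,
    Program.op_circuit_ket, Program.run_reverse_run,
    Program.run_of_not_target _ (computeProgram_target n)]

theorem op_reflectionCircuit_clean (n : ℕ) (p : Bool) (l z y : Fin m → Bool) :
    Circuit.op O (reflectionCircuit n m) *ᵥ ket (clean true p l z y) =
      (if z = fun _ => false then (1 : ℂ) else -1) • ket (clean true p l z y) := by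
  rw [op_reflectionCircuit, run_computeProgram]
  have h1 : computed n true p l z y (wireW (Fin.last m) 0) = orChain (ext z) m := by
    simp [computed, workBit]
  have h2 : (orChain (ext z) m = false) ↔ z = fun _ => false := by
    rw [orChain_eq_false_iff]
    constructor
    · intro h
      funext i
      simpa using h i i.2
    · rintro rfl i hi
      simp [ext]
  rw [h1]
  cases h : orChain (ext z) m
  · rw [if_pos (h2.1 h), if_neg (by simp)]
  · have h3 : ¬ z = fun _ => false := fun h' => by
      rw [h2.2 h'] at h
      cases h
    rw [if_neg h3]
    rfl

/-- The wires of the controlled oracle. -/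
def oracleWires (m : ℕ) : Option (Fin m) ↪ Reg m where
  toFun
    | none => wireQ
    | some i => wireZ i
  inj' := by
    rintro (_ | i) (_ | j) h <;> simp_all

theorem op_controlled_clean (U : Operator (Fin m)) (p : Bool) (l z y : Fin m → Bool) :
    onWires (oracleWires m) (controlled U) *ᵥ ket (clean true p l z y) =
      ∑ z', U z' z • ket (clean true p l z' y) := by
  rw [onWires_controlled_ket, if_pos (show clean true p l z y (oracleWires m none) = true from rfl),
    onWires_ket]
  refine Finset.sum_congr rfl fun z' _ => ?_
  have : clean true p l z' y = Function.extend
      ((Function.Embedding.some).trans (oracleWires m)) z' (clean true p l z y) := by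
    rw [eq_extend_iff]
    refine ⟨fun w hw => ?_, rfl⟩
    rcases w with _ | i | (i | i) | (_ | _) | ⟨i, k⟩ <;> try rfl
    exact absurd rfl (hw i)
  rw [this]
  rfl

/-- The controlled walk operator. -/
noncomputable def walkCircuit (n m : ℕ) : Circuit (Reg m) m :=
  .call (oracleWires m) :: ((shiftProgram n m).circuit ++
    (.callInv (oracleWires m) :: reflectionCircuit n m))

theorem calls_walkCircuit (n m : ℕ) : (walkCircuit n m).calls = 2 := by
  have h1 := Program.calls_circuit (m := m) (shiftProgram n m)
  have h2 := Program.calls_circuit (m := m) (computeProgram n m)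
  have h3 := Program.calls_circuit (m := m) (computeProgram n m).reverse
  simp only [Circuit.calls] at h1 h2 h3
  simp [walkCircuit, reflectionCircuit, Circuit.calls, Step.calls, h1, h2, h3, controlledSign]

theorem gates_walkCircuit (n m : ℕ) : (walkCircuit n m).gates = 705 * m + 286 := by
  have h1 := Program.gates_circuit (m := m) (shiftProgram n m)
  have h2 := Program.gates_circuit (m := m) (computeProgram n m)
  have h3 := Program.gates_circuit (m := m) (computeProgram n m).reverse
  rw [List.length_reverse] at h3
  rw [length_computeProgram] at h2 h3
  rw [length_shiftProgram] at h1
  simp only [Circuit.gates] at h1 h2 h3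
  simp [walkCircuit, reflectionCircuit, Circuit.gates, Step.gates, h1, h2, h3, controlledSign]
  ring

theorem op_walkCircuit (n m : ℕ) (O : Matrix.unitaryGroup (Fin m → Bool) ℂ) :
    Circuit.op O (walkCircuit n m) = Circuit.op O (reflectionCircuit n m) *
      (onWires (oracleWires m) (controlled O.1ᴴ) * (Circuit.op O (shiftProgram n m).circuit *
        onWires (oracleWires m) (controlled O.1))) := by
  rw [walkCircuit, Circuit.op, Circuit.op_append, Circuit.op, Step.op, Step.op]
  simp only [Matrix.mul_assoc]

/-- All four factors are trivial on every basis state with control `0`, clean or not; the operator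
identities `walk_mul_lower` and `walk_mul_upper` need this generality. -/
theorem op_walkCircuit_of_not (n : ℕ) (b : Reg m → Bool) (hb : b wireQ = false) :
    Circuit.op O (walkCircuit n m) *ᵥ ket b = ket b := by
  have h : ∀ U : Operator (Fin m), onWires (oracleWires m) (controlled U) *ᵥ ket b = ket b :=
    fun U => by
      rw [onWires_controlled_ket, if_neg]
      exact Bool.eq_false_iff.1 hb
  simp only [op_walkCircuit, ← Matrix.mulVec_mulVec, h, Program.op_circuit_ket,
    run_shiftProgram_of_not n b hb, op_reflectionCircuit, hb, Bool.false_and, one_smul,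
    Bool.false_eq_true, if_false]

end WalkCircuit

end QSim

namespace QSim

set_option linter.unusedSectionVars false

/-! ### Operators and rotations on the control qubit. -/

section ControlQubit

variable {ι : Type} [Fintype ι] [DecidableEq ι] {m : ℕ}

/-- The operator that acts on the wire `q` by a fixed matrix. -/
def onQubit (q : ι) (A : Matrix Bool Bool ℂ) : Operator ι := onTarget q fun _ => A

theorem onQubit_mul (q : ι) (A B : Matrix Bool Bool ℂ) :
    onQubit q A * onQubit q B = onQubit q (A * B) :=
  onTarget_mul q fun _ _ => rfl

theorem onQubit_one (q : ι) : onQubit q 1 = 1 := onTarget_one q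

theorem onQubit_add (q : ι) (A B : Matrix Bool Bool ℂ) :
    onQubit q (A + B) = onQubit q A + onQubit q B := by
  ext a b
  simp only [onQubit, onTarget, Matrix.add_apply]
  split_ifs <;> simp

theorem onQubit_smul (q : ι) (c : ℂ) (A : Matrix Bool Bool ℂ) :
    onQubit q (c • A) = c • onQubit q A := by
  ext a b
  simp only [onQubit, onTarget, Matrix.smul_apply]
  split_ifs <;> simp

theorem onQubit_conjTranspose (q : ι) (A : Matrix Bool Bool ℂ) :
    (onQubit q A)ᴴ = onQubit q Aᴴ :=
  onTarget_conjTranspose q fun _ _ => rfl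

theorem onQubit_ket (q : ι) (A : Matrix Bool Bool ℂ) (b : ι → Bool) :
    onQubit q A *ᵥ ket b = ∑ c, A c (b q) • ket (Function.update b q c) :=
  onTarget_ket q _ b

/-- The rotation with first column `r`. -/
def rotation (r : ℂ × ℂ) : Matrix Bool Bool ℂ
  | false, false => r.1
  | true, false => r.2
  | false, true => -star r.2
  | true, true => star r.1

theorem rotation_mul_conjTranspose {r : ℂ × ℂ} (hr : ‖r.1‖ ^ 2 + ‖r.2‖ ^ 2 = 1) :
    rotation r * (rotation r)ᴴ = 1 := by
  have h : r.1 * star r.1 + r.2 * star r.2 = 1 := by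
    rw [Complex.star_def, Complex.mul_conj, Complex.mul_conj,
      Complex.normSq_eq_norm_sq, Complex.normSq_eq_norm_sq, ← Complex.ofReal_add, hr]
    simp
  ext s t
  cases s <;> cases t <;>
    simp only [Matrix.mul_apply, Fintype.sum_bool, Matrix.conjTranspose_apply, rotation,
      star_neg, star_star, Matrix.one_apply, if_true, reduceCtorEq, if_false]
  · linear_combination h
  · ring
  · ring
  · linear_combination h

theorem rotation_mul_single_false (r : ℂ × ℂ) :
    rotation r * Matrix.single false true (1 : ℂ) =
      r.1 • Matrix.single false true 1 + r.2 • Matrix.single true true 1 := by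
  ext s t
  cases s <;> cases t <;> simp [Matrix.mul_apply, rotation, Matrix.single_apply]

theorem rotation_mul_single_true (r : ℂ × ℂ) :
    rotation r * Matrix.single true true (1 : ℂ) =
      (-star r.2) • Matrix.single false true 1 + star r.1 • Matrix.single true true 1 := by
  ext s t
  cases s <;> cases t <;> simp [Matrix.mul_apply, rotation, Matrix.single_apply]

open Classical in
/-- The rotation of a qubit, as a gate. -/
noncomputable def rotationStep (q : ι) (r : ℂ × ℂ) : Step ι m :=
  .gate₁ ⟨fun _ => q, fun _ _ _ => Subsingleton.elim _ _⟩
    (if h : ‖r.1‖ ^ 2 + ‖r.2‖ ^ 2 = 1 then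
      ⟨onQubit 0 (rotation r), onTarget_mem_unitaryGroup 0 (fun _ _ => rfl)
        fun _ => rotation_mul_conjTranspose h⟩
    else 1)

theorem op_rotationStep (O : Matrix.unitaryGroup (Fin m → Bool) ℂ) (q : ι) {r : ℂ × ℂ}
    (hr : ‖r.1‖ ^ 2 + ‖r.2‖ ^ 2 = 1) : (rotationStep q r).op O = onQubit q (rotation r) := by
  rw [rotationStep, Step.op, dif_pos hr]
  exact onWires_onTarget (κ := Fin 1) _ 0 fun _ => rotation r

end ControlQubit

/-! ### Signal processing circuits evaluate polynomials at the walk operator. -/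

section SignalProcessing

open Polynomial

/-- The circuit of signal processing, with walk operator given by the circuit `w`. -/
noncomputable def signalCircuit {ι : Type} [Fintype ι] [DecidableEq ι] {m : ℕ} (q : ι)
    (w : Circuit ι m) : List (ℂ × ℂ) → Circuit ι m
  | [] => []
  | r :: L => signalCircuit q w L ++ (w ++ [rotationStep q r])

variable {ι : Type} [Fintype ι] [DecidableEq ι] {m : ℕ} (q : ι) (w : Circuit ι m)

theorem calls_signalCircuit (L : List (ℂ × ℂ)) :
    (signalCircuit q w L).calls = L.length * w.calls := by
  induction L with
  | nil => simp [signalCircuit, Circuit.calls]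
  | cons r L ih =>
    rw [signalCircuit, Circuit.calls_append, Circuit.calls_append, ih, List.length_cons]
    change _ + (_ + 0) = _
    ring

theorem gates_signalCircuit (L : List (ℂ × ℂ)) :
    (signalCircuit q w L).gates = L.length * (w.gates + 1) := by
  induction L with
  | nil => simp [signalCircuit, Circuit.gates]
  | cons r L ih =>
    rw [signalCircuit, Circuit.gates_append, Circuit.gates_append, ih, List.length_cons]
    change _ + (_ + 1) = _
    ring

/-- `G` already contains its control, so polynomials in it are meaningful where the control is `1`.
The factor `|0⟩⟨1|` transfers this sector to the control value `0`, where `G` is trivial by `h0`; in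
the `|1⟩⟨1|` term `G` passes to the right by `h1`. Each step thus multiplies only the second
polynomial by the variable. -/
theorem op_signalCircuit (O : Matrix.unitaryGroup (Fin m → Bool) ℂ)
    (h0 : Circuit.op O w * onQubit q (Matrix.single false true 1) =
      onQubit q (Matrix.single false true 1))
    (h1 : Circuit.op O w * onQubit q (Matrix.single true true 1) =
      onQubit q (Matrix.single true true 1) * Circuit.op O w)
    (L : List (ℂ × ℂ)) (hL : ∀ r ∈ L, ‖r.1‖ ^ 2 + ‖r.2‖ ^ 2 = 1) :
    Circuit.op O (signalCircuit q w L) * onQubit q (Matrix.single false true 1) =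
      onQubit q (Matrix.single false true 1) * aeval (Circuit.op O w) (signalPair L).1 +
      onQubit q (Matrix.single true true 1) * aeval (Circuit.op O w) (signalPair L).2 := by
  induction L with
  | nil => simp [signalCircuit, Circuit.op, signalPair]
  | cons r L ih =>
    rw [signalCircuit, Circuit.op_append, Circuit.op_append, Circuit.op, Circuit.op,
      Matrix.one_mul, op_rotationStep O q (hL r List.mem_cons_self), Matrix.mul_assoc,
      ih fun r' hr' => hL r' (List.mem_cons_of_mem _ hr'), signalPair]
    set G := Circuit.op O w
    set P := (signalPair L).1
    set Q := (signalPair L).2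
    rw [Matrix.mul_assoc, Matrix.mul_add, ← Matrix.mul_assoc G, h0, ← Matrix.mul_assoc G, h1,
      Matrix.mul_assoc _ G, Matrix.mul_add, ← Matrix.mul_assoc, ← Matrix.mul_assoc,
      onQubit_mul, onQubit_mul, rotation_mul_single_false, rotation_mul_single_true]
    simp only [onQubit_add, onQubit_smul, map_add, map_sub, map_mul, aeval_X, aeval_C,
      Algebra.algebraMap_eq_smul_one, Matrix.add_mul, Matrix.mul_add, Matrix.mul_sub,
      Matrix.mul_smul, smul_mul_assoc, one_mul,
      Complex.star_def]
    module

end SignalProcessing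

/-! ### Norm estimates for isometries and for the truncated evolution. -/

section Norms

open scoped Matrix.Norms.L2Operator

variable {κ μ : Type} [Fintype κ] [Fintype μ] [DecidableEq κ] [DecidableEq μ]

theorem norm_le_one_of_isometry [Nonempty μ] {Z : Matrix κ μ ℂ} (h : Zᴴ * Z = 1) : ‖Z‖ = 1 := by
  have h1 := Matrix.l2_opNorm_conjTranspose_mul_self Z
  rw [h, norm_one] at h1
  nlinarith [norm_nonneg Z]

/-- Two isometries are close if they are close on the range of one of them. -/
theorem norm_sub_le_of_isometry [Nonempty μ] {Z E : Matrix κ μ ℂ} {U B : Matrix μ μ ℂ}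
    (hZ : Zᴴ * Z = 1) (hE : Eᴴ * E = 1) (hU : Uᴴ * U = 1) (hB : Eᴴ * Z = B) {ε : ℝ}
    (hε : 0 ≤ ε) (h : ‖B - U‖ ≤ ε ^ 2 / 2) : ‖Z - E * U‖ ≤ ε := by
  have h1 := Matrix.l2_opNorm_conjTranspose_mul_self (Z - E * U)
  have hB' : Zᴴ * E = Bᴴ := by rw [← hB, Matrix.conjTranspose_mul, Matrix.conjTranspose_conjTranspose]
  -- Both `Z` and `E * U` are isometries, so the constant terms cancel and the squared distance is
  -- linear in `B - U`. This also bounds the part of `Z` that leaves the range of `E`.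
  have h2 : (Z - E * U)ᴴ * (Z - E * U) = -((B - U)ᴴ * U + Uᴴ * (B - U)) := by
    rw [Matrix.conjTranspose_sub, Matrix.conjTranspose_sub, Matrix.conjTranspose_mul,
      Matrix.sub_mul, Matrix.mul_sub, Matrix.mul_sub, hZ, Matrix.mul_assoc Uᴴ, hB,
      ← Matrix.mul_assoc, hB', Matrix.mul_assoc Uᴴ, ← Matrix.mul_assoc Eᴴ, hE, Matrix.one_mul, hU,
      Matrix.sub_mul, Matrix.mul_sub, hU]
    abel
  have hU1 := norm_le_one_of_isometry hU
  have h3 : ‖(Z - E * U)ᴴ * (Z - E * U)‖ ≤ ε ^ 2 := by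
    rw [h2, norm_neg]
    calc _ ≤ ‖(B - U)ᴴ * U‖ + ‖Uᴴ * (B - U)‖ := norm_add_le _ _
      _ ≤ ‖(B - U)ᴴ‖ * ‖U‖ + ‖Uᴴ‖ * ‖B - U‖ :=
        add_le_add (Matrix.l2_opNorm_mul _ _) (Matrix.l2_opNorm_mul _ _)
      _ = 2 * ‖B - U‖ := by
        rw [Matrix.l2_opNorm_conjTranspose, Matrix.l2_opNorm_conjTranspose, hU1]; ring
      _ ≤ ε ^ 2 := by linarith
  rw [h1] at h3
  nlinarith [norm_nonneg (Z - E * U)]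

theorem norm_submatrix_equiv {κ' : Type} [Fintype κ'] [DecidableEq κ'] (A : Matrix κ μ ℂ)
    {e : κ' → κ} (he : Function.Bijective e) : ‖A.submatrix e id‖ = ‖A‖ := by
  have h1 := Matrix.l2_opNorm_conjTranspose_mul_self (A.submatrix e id)
  rw [Matrix.conjTranspose_submatrix, ← Matrix.submatrix_mul _ _ _ _ _ he,
    Matrix.submatrix_id_id, Matrix.l2_opNorm_conjTranspose_mul_self] at h1
  nlinarith [norm_nonneg A, norm_nonneg (A.submatrix e id)]

theorem evolution_conjTranspose_mul {H : Matrix κ κ ℂ} (hH : Hᴴ = H) (t : ℝ) :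
    (evolution H t)ᴴ * evolution H t = 1 := by
  have h : (-(Complex.I * (t : ℂ)) • H)ᴴ = -(-(Complex.I * (t : ℂ)) • H) := by
    rw [Matrix.conjTranspose_smul, hH, ← neg_smul]
    congr 1
    simp
  rw [evolution, ← Matrix.exp_conjTranspose, h,
    ← Matrix.exp_add_of_commute (-(-(Complex.I * (t : ℂ)) • H)) (-(Complex.I * (t : ℂ)) • H)
      (Commute.refl (-(Complex.I * (t : ℂ)) • H)).neg_left, neg_add_cancel,
    NormedSpace.exp_zero]

/-- The truncated exponential series of a contraction, divided by `s`, is close to the time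
evolution. -/
theorem norm_truncated_sub_evolution_le [Nonempty κ] {H : Matrix κ κ ℂ} (hH : Hᴴ = H)
    (hH1 : ‖H‖ ≤ 1) {t δ : ℝ} (ht0 : 0 ≤ t) {n : ℕ} (ht : t / (n + 1) ≤ 1 / 2)
    (hδ : 2 * (t ^ n / n.factorial) ≤ δ) :
    ‖((1 + δ : ℝ) : ℂ)⁻¹ • ∑ k ∈ Finset.range n, evolutionCoeff t k • H ^ k - evolution H t‖
      ≤ 2 * δ := by
  have hδ0 : 0 ≤ δ := le_trans (by positivity) hδ
  have hU := norm_le_one_of_isometry (evolution_conjTranspose_mul hH t)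
  set T := ∑ k ∈ Finset.range n, evolutionCoeff t k • H ^ k with hT
  set U := evolution H t with hUdef
  have h1 : ‖U - T‖ ≤ δ := by
    have h2 : ‖-(Complex.I * (t : ℂ)) • H‖ ≤ t := by
      rw [norm_smul, norm_neg, norm_mul, Complex.norm_I, one_mul, Complex.norm_real,
        Real.norm_of_nonneg ht0]
      nlinarith
    have h3 := norm_exp_sub_sum_le _ h2 ht
    have h4 : T = ∑ k ∈ Finset.range n,
        ((k.factorial : ℂ))⁻¹ • (-(Complex.I * (t : ℂ)) • H) ^ k := by
      refine Finset.sum_congr rfl fun k _ => ?_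
      rw [smul_pow, smul_smul, evolutionCoeff, mul_comm]
    rw [h4]
    exact h3.trans hδ
  have hs : ((1 + δ : ℝ) : ℂ) ≠ 0 := Complex.ofReal_ne_zero.2 (by linarith)
  -- One `δ` is for the truncation and one for the division by `1 + δ`.
  have h5 : ((1 + δ : ℝ) : ℂ)⁻¹ • T - U =
      ((1 + δ : ℝ) : ℂ)⁻¹ • (-(U - T) - (δ : ℂ) • U) := by
    have h6 : U = ((1 + δ : ℝ) : ℂ)⁻¹ • ((1 + δ : ℝ) : ℂ) • U := by
      rw [smul_smul, inv_mul_cancel₀ hs, one_smul]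
    nth_rw 1 [h6]
    rw [← smul_sub]
    congr 1
    push_cast
    module
  have h7 : ‖((1 + δ : ℝ) : ℂ)⁻¹‖ ≤ 1 := by
    rw [norm_inv, Complex.norm_real, Real.norm_of_nonneg (by linarith)]
    exact inv_le_one_of_one_le₀ (by linarith)
  have h8 : ‖-(U - T) - (δ : ℂ) • U‖ ≤ 2 * δ := by
    calc _ ≤ ‖-(U - T)‖ + ‖(δ : ℂ) • U‖ := norm_sub_le _ _
      _ ≤ δ + δ * 1 := by
        rw [norm_neg, norm_smul, hU, Complex.norm_real, Real.norm_of_nonneg hδ0]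
        gcongr
      _ = 2 * δ := by ring
  rw [h5, norm_smul]
  calc _ ≤ 1 * (2 * δ) := by gcongr
    _ = 2 * δ := one_mul _

end Norms

end QSim

namespace QSim

/-! ### The encoding of the simulated space in the wires. -/

section Encoding

variable {n : ℕ}

/-- The bits that encode `(p, l)`, with control qubit `q`. -/
def encodedBits (q : Bool) (v : Bool × Fin n) : Reg (numQubits n) → Bool :=
  clean q v.1 (bits v.2) (fun _ => false) fun _ => false

/-- The encoding of `ℂ² ⊗ ℂⁿ`, with control qubit `q`. -/
def encodeReg (n : ℕ) (q : Bool) : Matrix (Reg (numQubits n) → Bool) (Bool × Fin n) ℂ :=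
  fun b v => if b = encodedBits q v then 1 else 0

theorem bits_injective : Function.Injective (bits : Fin n → Fin (numQubits n) → Bool) := by
  intro a b h
  have h1 := congrArg ext h
  rw [ext_bits, ext_bits] at h1
  exact Fin.ext (Nat.eq_of_testBit_eq fun i => congrFun h1 i)

theorem encodedBits_injective (q : Bool) : Function.Injective (encodedBits (n := n) q) := by
  intro v w h
  refine Prod.ext (congrFun h wireP) (bits_injective ?_)
  funext i
  exact congrFun h (wireL i)

theorem encodeReg_single (q : Bool) (v : Bool × Fin n) :
    encodeReg n q *ᵥ Pi.single v 1 = ket (encodedBits q v) := by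
  funext b
  rw [Matrix.mulVec_single_one, ket_apply]
  rfl

theorem ext_single {μ κ : Type} [Fintype κ] [DecidableEq κ] {A B : Matrix μ κ ℂ}
    (h : ∀ v : κ, A *ᵥ Pi.single v 1 = B *ᵥ Pi.single v 1) : A = B := by
  ext a v
  have h1 := congrFun (h v) a
  simpa using h1

theorem encodeReg_conjTranspose_mul (q : Bool) : (encodeReg n q)ᴴ * encodeReg n q = 1 := by
  ext v w
  rw [Matrix.mul_apply, Finset.sum_eq_single (encodedBits q v)]
  · simp [encodeReg, Matrix.one_apply, (encodedBits_injective q).eq_iff]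
  · intro b _ hb
    simp [encodeReg, hb]
  · simp

theorem update_wireQ (q q' : Bool) (v : Bool × Fin n) :
    Function.update (encodedBits q v) wireQ q' = encodedBits q' v := by
  refine Eq.symm ((eq_update_iff' _ _ _ _).2 ⟨fun w hw => ?_, rfl⟩)
  rcases w with _ | i | (i | i) | (_ | _) | ⟨i, k⟩ <;> first | rfl | exact absurd rfl hw

theorem onQubit_encodeReg (A : Matrix Bool Bool ℂ) (q : Bool) :
    onQubit (wireQ : Reg (numQubits n)) A * encodeReg n q =
      A false q • encodeReg n false + A true q • encodeReg n true := by
  refine ext_single fun v => ?_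
  rw [← Matrix.mulVec_mulVec, encodeReg_single, onQubit_ket, Fintype.sum_bool, update_wireQ,
    update_wireQ, Matrix.add_mulVec, Matrix.smul_mulVec, Matrix.smul_mulVec, encodeReg_single,
    encodeReg_single, add_comm]
  rfl

end Encoding

/-! ### The Hamiltonian as the Hermitian part of the walk operator. -/

section Walk

variable {n : ℕ} {x : Fin n → ℝ} {O : Matrix.unitaryGroup (Fin (numQubits n) → Bool) ℂ}

theorem oracle_column (hO : PreparesSqrt x O) (z : Fin (numQubits n) → Bool) :
    O.1 z (fun _ => false) = ∑ j, if z = bits j then ((Real.sqrt (x j) : ℝ) : ℂ) else 0 := by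
  have h := congrFun hO z
  rw [mulVec_ket_apply, Finset.sum_apply] at h
  rw [h]
  simp [ket_apply]

theorem oracle_entry (hO : PreparesSqrt x O) (j : Fin n) :
    O.1 (bits j) (fun _ => false) = ((Real.sqrt (x j) : ℝ) : ℂ) := by
  rw [oracle_column hO]
  simp [bits_injective.eq_iff]

theorem op_call_encoded (hO : PreparesSqrt x O) (v : Bool × Fin n) :
    onWires (oracleWires (numQubits n)) (controlled O.1) *ᵥ ket (encodedBits true v) =
      ∑ j, ((Real.sqrt (x j) : ℝ) : ℂ) •
        ket (clean true v.1 (bits v.2) (bits j) fun _ => false) := by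
  rw [encodedBits, op_controlled_clean]
  simp only [oracle_column hO, Finset.sum_smul]
  rw [Finset.sum_comm]
  refine Finset.sum_congr rfl fun j _ => ?_
  simp [ite_smul]

/-- The image of an encoded basis vector under the walk operator before the reflection. -/
noncomputable def shiftedVector (x : Fin n → ℝ)
    (O : Matrix.unitaryGroup (Fin (numQubits n) → Bool) ℂ) (v : Bool × Fin n) :
    (Reg (numQubits n) → Bool) → ℂ :=
  ∑ j, ((Real.sqrt (x j) : ℝ) : ℂ) • ∑ z, O.1ᴴ z (bits j) •
    ket (clean true (!v.1) (bits (shiftIndex v.1 v.2 j)) z fun _ => false)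

theorem op_shift_clean (v : Bool × Fin n) (j : Fin n) :
    Circuit.op O (shiftProgram n (numQubits n)).circuit *ᵥ
        ket (clean true v.1 (bits v.2) (bits j) fun _ => false) =
      ket (clean true (!v.1) (bits (shiftIndex v.1 v.2 j)) (bits j) fun _ => false) := by
  rw [Program.op_circuit_ket, run_shiftProgram_bits]

/-- The shift flips the dilation qubit and thereby its own direction, so it is an involution on
these states and agrees there with its adjoint. -/
theorem op_shift_conjTranspose_clean (v : Bool × Fin n) (j : Fin n) :
    (Circuit.op O (shiftProgram n (numQubits n)).circuit)ᴴ *ᵥ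
        ket (clean true v.1 (bits v.2) (bits j) fun _ => false) =
      ket (clean true (!v.1) (bits (shiftIndex v.1 v.2 j)) (bits j) fun _ => false) := by
  have h := op_shift_clean (O := O) (!v.1, shiftIndex v.1 v.2 j) j
  simp only [shiftIndex_shiftIndex, Bool.not_not] at h
  rw [← h, Matrix.mulVec_mulVec, Circuit.conjTranspose_op_mul, Matrix.one_mulVec]

theorem op_walk_encoded (hO : PreparesSqrt x O) (v : Bool × Fin n) :
    Circuit.op O (walkCircuit n (numQubits n)) *ᵥ ket (encodedBits true v) =
      Circuit.op O (reflectionCircuit n (numQubits n)) *ᵥ shiftedVector x O v := by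
  rw [op_walkCircuit, ← Matrix.mulVec_mulVec, ← Matrix.mulVec_mulVec, ← Matrix.mulVec_mulVec,
    op_call_encoded hO]
  simp only [Matrix.mulVec_sum, Matrix.mulVec_smul, op_shift_clean, op_controlled_clean,
    shiftedVector]

/-- In the adjoint the reflection acts first and fixes encoded vectors; what remains is the oracle,
the shift and the inverse oracle, without a reflection. -/
theorem op_walk_conjTranspose_encoded (hO : PreparesSqrt x O) (v : Bool × Fin n) :
    (Circuit.op O (walkCircuit n (numQubits n)))ᴴ *ᵥ ket (encodedBits true v) =
      shiftedVector x O v := by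
  have hR : (Circuit.op O (reflectionCircuit n (numQubits n)))ᴴ *ᵥ ket (encodedBits true v) =
      ket (encodedBits true v) := by
    have h := op_reflectionCircuit_clean O n v.1 (bits v.2) (fun _ => false) fun _ => false
    rw [if_pos rfl, one_smul] at h
    nth_rw 1 [encodedBits]
    rw [← h, Matrix.mulVec_mulVec, Circuit.conjTranspose_op_mul, Matrix.one_mulVec]
    rfl
  rw [op_walkCircuit, Matrix.conjTranspose_mul, Matrix.conjTranspose_mul,
    Matrix.conjTranspose_mul, onWires_conjTranspose, onWires_conjTranspose,
    controlled_conjTranspose, controlled_conjTranspose, Matrix.conjTranspose_conjTranspose,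
    ← Matrix.mulVec_mulVec, ← Matrix.mulVec_mulVec, ← Matrix.mulVec_mulVec, hR,
    op_call_encoded hO]
  simp only [Matrix.mulVec_sum, Matrix.mulVec_smul, op_shift_conjTranspose_clean,
    op_controlled_clean, shiftedVector]

/-- Reflection plus identity is twice the projection to `|0…0⟩` in the oracle register; there the
inverse oracle contributes a second factor `√x_j`. -/
theorem reflection_add_shiftedVector (hx : ∀ j, 0 ≤ x j) (hO : PreparesSqrt x O)
    (v : Bool × Fin n) :
    Circuit.op O (reflectionCircuit n (numQubits n)) *ᵥ shiftedVector x O v +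
        shiftedVector x O v =
      (2 : ℂ) • ∑ j, (x j : ℂ) • ket (encodedBits true (!v.1, shiftIndex v.1 v.2 j)) := by
  simp only [shiftedVector, Matrix.mulVec_sum, Matrix.mulVec_smul, op_reflectionCircuit_clean,
    Finset.smul_sum, ← Finset.sum_add_distrib]
  refine Finset.sum_congr rfl fun j _ => ?_
  rw [Finset.sum_eq_single fun _ => false]
  · rw [if_pos rfl, Matrix.conjTranspose_apply, oracle_entry hO, Complex.star_def,
      Complex.conj_ofReal, one_smul, ← two_smul ℂ, smul_smul, smul_smul, smul_smul, mul_assoc,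
      ← Complex.ofReal_mul, Real.mul_self_sqrt (hx j)]
    rfl
  · intro z _ hz
    rw [if_neg hz]
    simp
  · simp

theorem extended_circ_column (v : Bool × Fin n) (u : Bool × Fin n) :
    extended (circ x) u v = ∑ j, (x j : ℂ) * if u = (!v.1, shiftIndex v.1 v.2 j) then 1 else 0 := by
  have : NeZero n := ⟨by rintro rfl; exact v.2.elim0⟩
  obtain ⟨p, a⟩ := v
  obtain ⟨p', a'⟩ := u
  have h1 : ∀ j : Fin n, a' = a - j ↔ j = a - a' := fun j =>
    ⟨fun h => by rw [h]; abel, fun h => by rw [h]; abel⟩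
  have h2 : ∀ j : Fin n, a' = a + j ↔ j = a' - a := fun j =>
    ⟨fun h => by rw [h]; abel, fun h => by rw [h]; abel⟩
  cases p <;> cases p' <;>
    simp [extended, circ, Matrix.add_apply, Matrix.kroneckerMap_apply, Matrix.circulant_apply,
      shiftIndex, h1, h2]

/-- The Hermitian part of the walk operator acts on encoded vectors as the Hamiltonian. -/
theorem walk_add_conjTranspose_mul_encodeReg (hx : ∀ j, 0 ≤ x j) (hO : PreparesSqrt x O) :
    (Circuit.op O (walkCircuit n (numQubits n)) +
        (Circuit.op O (walkCircuit n (numQubits n)))ᴴ) * encodeReg n true =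
      encodeReg n true * ((2 : ℂ) • extended (circ x)) := by
  refine ext_single fun v => ?_
  rw [← Matrix.mulVec_mulVec, encodeReg_single, Matrix.add_mulVec, op_walk_encoded hO,
    op_walk_conjTranspose_encoded hO, reflection_add_shiftedVector hx hO]
  funext b
  simp only [Matrix.mulVec_single_one, Matrix.col_apply, Matrix.mul_apply, Pi.smul_apply,
    Finset.sum_apply, Matrix.smul_apply, extended_circ_column, ket_apply, smul_eq_mul,
    Finset.mul_sum, encodeReg]
  rw [Finset.sum_comm]
  refine Finset.sum_congr rfl fun j _ => ?_
  rw [Finset.sum_eq_single (!v.1, shiftIndex v.1 v.2 j)]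
  · simp only [if_true, mul_one]
    ring
  · intro u _ hu
    simp [hu]
  · simp

theorem extended_circ_conjTranspose : (extended (circ x))ᴴ = extended (circ x) := by
  rw [extended, Matrix.conjTranspose_add, Matrix.conjTranspose_kronecker,
    Matrix.conjTranspose_kronecker, Matrix.conjTranspose_conjTranspose, add_comm]
  simp

theorem walk_mul_lower (n m : ℕ) (O : Matrix.unitaryGroup (Fin m → Bool) ℂ) (t : Bool) :
    Circuit.op O (walkCircuit n m) * onQubit wireQ (Matrix.single false t 1) =
      onQubit wireQ (Matrix.single false t 1) := by
  refine ext_ket fun b => ?_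
  rw [← Matrix.mulVec_mulVec, onQubit_ket, Fintype.sum_bool, Matrix.mulVec_add,
    Matrix.mulVec_smul, Matrix.mulVec_smul, op_walkCircuit_of_not O n _ (Function.update_self ..)]
  simp

/-- A unitary that fixes the range of `|0⟩⟨0|` on the control commutes with this projection, hence
with the complementary one. -/
theorem walk_mul_upper (n m : ℕ) (O : Matrix.unitaryGroup (Fin m → Bool) ℂ) :
    Circuit.op O (walkCircuit n m) * onQubit wireQ (Matrix.single true true 1) =
      onQubit wireQ (Matrix.single true true 1) * Circuit.op O (walkCircuit n m) := by
  set G := Circuit.op O (walkCircuit n m)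
  have h1 : G * onQubit wireQ (Matrix.single false false 1) =
      onQubit wireQ (Matrix.single false false 1) := walk_mul_lower n m O false
  have h2 : onQubit wireQ (Matrix.single false false 1) * G =
      onQubit wireQ (Matrix.single false false 1) := by
    have h3 := congrArg (fun A => Gᴴ * A) h1
    simp only [← Matrix.mul_assoc] at h3
    rw [Circuit.conjTranspose_op_mul, Matrix.one_mul] at h3
    have h4 := congrArg Matrix.conjTranspose h3
    rw [Matrix.conjTranspose_mul, Matrix.conjTranspose_conjTranspose, onQubit_conjTranspose,
      Matrix.conjTranspose_single, star_one] at h4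
    exact h4.symm
  have h5 : onQubit (wireQ : Reg m) (Matrix.single true true 1) =
      1 - onQubit wireQ (Matrix.single false false 1) := by
    rw [eq_sub_iff_add_eq, ← onQubit_add, ← onQubit_one]
    congr 1
    ext s t
    cases s <;> cases t <;> simp
  rw [h5, Matrix.mul_sub, Matrix.sub_mul, h1, h2, Matrix.mul_one, Matrix.one_mul]

end Walk

/-! ### The simulation circuit, its error and its cost. -/

section Simulation

open Polynomial

variable {n : ℕ}

/-- The simulation circuit: `k` inverse steps of the walk, and signal processing. -/
noncomputable def simulationCircuit (n k : ℕ) (L : List (ℂ × ℂ)) :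
    Circuit (Reg (numQubits n)) (numQubits n) :=
  rotationStep wireQ (0, 1) ::
    ((List.replicate k (Circuit.inv (walkCircuit n (numQubits n)))).flatten ++
      (rotationStep wireQ (0, -1) ::
        signalCircuit wireQ (walkCircuit n (numQubits n)) L))

theorem calls_simulationCircuit (n k : ℕ) (L : List (ℂ × ℂ)) :
    (simulationCircuit n k L).calls = 2 * (k + L.length) := by
  have h : ∀ c : Circuit (Reg (numQubits n)) (numQubits n),
      Circuit.calls (List.replicate k c).flatten = k * c.calls := fun c => by
    induction k with
    | zero => simp [Circuit.calls]
    | succ k ih =>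
      rw [List.replicate_succ, List.flatten_cons, Circuit.calls_append, ih]; ring
  have h1 := h (Circuit.inv (walkCircuit n (numQubits n)))
  have h2 := calls_signalCircuit wireQ (walkCircuit n (numQubits n)) L
  rw [Circuit.calls_inv] at h1
  rw [calls_walkCircuit] at h1 h2
  change 0 + Circuit.calls (_ ++ _) = _
  rw [Circuit.calls_append, h1]
  change 0 + (_ + (0 + Circuit.calls _)) = _
  rw [h2]
  ring

theorem gates_simulationCircuit (n k : ℕ) (L : List (ℂ × ℂ)) :
    (simulationCircuit n k L).gates =
      (k + L.length) * (705 * numQubits n + 286) + L.length + 2 := by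
  have h : ∀ c : Circuit (Reg (numQubits n)) (numQubits n),
      Circuit.gates (List.replicate k c).flatten = k * c.gates := fun c => by
    induction k with
    | zero => simp [Circuit.gates]
    | succ k ih =>
      rw [List.replicate_succ, List.flatten_cons, Circuit.gates_append, ih]; ring
  have h1 := h (Circuit.inv (walkCircuit n (numQubits n)))
  have h2 := gates_signalCircuit wireQ (walkCircuit n (numQubits n)) L
  rw [Circuit.gates_inv] at h1
  rw [gates_walkCircuit] at h1 h2
  change 1 + Circuit.gates (_ ++ _) = _
  rw [Circuit.gates_append, h1]
  change 1 + (_ + (1 + Circuit.gates _)) = _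
  rw [h2]
  ring

theorem op_flatten_replicate {ι : Type} [Fintype ι] [DecidableEq ι] {m : ℕ}
    (O : Matrix.unitaryGroup (Fin m → Bool) ℂ) (k : ℕ) (c : Circuit ι m) :
    Circuit.op O (List.replicate k c).flatten = Circuit.op O c ^ k := by
  induction k with
  | zero => simp [Circuit.op]
  | succ k ih =>
    rw [List.replicate_succ, List.flatten_cons, Circuit.op_append, ih, pow_succ]

/-- `G² + 1 = (G + G†) G` turns `(G² + 1)^i G^(k-i)` into `(G + G†)^i G^k`, and `(G†)^k` removes the
last factor. -/
theorem aeval_evolutionPoly_mul {κ : Type} [Fintype κ] [DecidableEq κ] {G : Matrix κ κ ℂ}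
    (h1 : G * Gᴴ = 1) (h2 : Gᴴ * G = 1) (t s : ℝ) (k : ℕ) :
    aeval G (evolutionPoly t s k) * Gᴴ ^ k =
      (s : ℂ)⁻¹ • ∑ i ∈ Finset.range k, (evolutionCoeff t i * (2 ^ i)⁻¹) • (G + Gᴴ) ^ i := by
  have hcomm : Commute (G + Gᴴ) G := by
    change (G + Gᴴ) * G = G * (G + Gᴴ)
    rw [Matrix.add_mul, Matrix.mul_add, h1, h2]
  have h3 : G ^ 2 + 1 = (G + Gᴴ) * G := by rw [Matrix.add_mul, h2, sq]
  have h4 : ∀ i, G ^ i * Gᴴ ^ i = 1 := fun i => by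
    rw [← Commute.mul_pow (show Commute G Gᴴ from h1.trans h2.symm), h1, one_pow]
  have h5 : ∀ (a : ℂ) (p : ℂ[X]), aeval G (C a * p) = a • aeval G p := fun a p => by
    rw [map_mul, aeval_C, Algebra.algebraMap_eq_smul_one, smul_mul_assoc, one_mul]
  rw [evolutionPoly, h5, map_sum, smul_mul_assoc, Finset.sum_mul]
  congr 1
  refine Finset.sum_congr rfl fun i hi => ?_
  rw [h5, smul_mul_assoc]
  congr 1
  simp only [map_mul, map_pow, map_add, aeval_X, map_one, h3]
  rw [hcomm.mul_pow, mul_assoc, mul_assoc, ← mul_assoc (G ^ i), ← pow_add,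
    Nat.add_sub_cancel' (Finset.mem_range.1 hi).le, h4, mul_one]

theorem pow_mul_of_mul_eq {κ μ : Type} [Fintype κ] [DecidableEq κ] [Fintype μ] [DecidableEq μ]
    {A : Matrix κ κ ℂ} {E : Matrix κ μ ℂ} {H : Matrix μ μ ℂ} (h : A * E = E * H) (i : ℕ) :
    A ^ i * E = E * H ^ i := by
  induction i with
  | zero => simp
  | succ i ih => rw [pow_succ, pow_succ', Matrix.mul_assoc, h, ← Matrix.mul_assoc, ih,
      Matrix.mul_assoc, ← pow_succ, ← pow_succ']

variable {x : Fin n → ℝ} {O : Matrix.unitaryGroup (Fin (numQubits n) → Bool) ℂ}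

theorem rotation_mul_encodeReg :
    onQubit (wireQ : Reg (numQubits n)) (rotation (0, 1)) * encodeReg n false =
      encodeReg n true := by
  rw [onQubit_encodeReg]
  simp [rotation]

theorem upper_mul_encodeReg :
    onQubit (wireQ : Reg (numQubits n)) (Matrix.single true true 1) * encodeReg n true =
      encodeReg n true := by
  rw [onQubit_encodeReg]
  simp

theorem encodeReg_mul_upper :
    (encodeReg n false)ᴴ * onQubit (wireQ : Reg (numQubits n)) (Matrix.single true true 1) = 0 := by
  have h : onQubit (wireQ : Reg (numQubits n)) (Matrix.single true true 1) *
      encodeReg n false = 0 := by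
    rw [onQubit_encodeReg]
    simp
  have h' := congrArg Matrix.conjTranspose h
  rwa [Matrix.conjTranspose_mul, onQubit_conjTranspose, Matrix.conjTranspose_single,
    star_one, Matrix.conjTranspose_zero] at h'

theorem encodeReg_mul_lower :
    (encodeReg n false)ᴴ * onQubit (wireQ : Reg (numQubits n)) (Matrix.single false true 1) =
      (encodeReg n true)ᴴ := by
  have h : onQubit (wireQ : Reg (numQubits n)) (Matrix.single true false 1) *
      encodeReg n false = encodeReg n true := by
    rw [onQubit_encodeReg]
    simp
  have h' := congrArg Matrix.conjTranspose h
  rwa [Matrix.conjTranspose_mul, onQubit_conjTranspose, Matrix.conjTranspose_single,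
    star_one] at h'

theorem rotation_mul_upper {ι : Type} [Fintype ι] [DecidableEq ι] (q : ι) :
    onQubit q (rotation (0, -1)) * onQubit q (Matrix.single true true 1) =
      onQubit q (Matrix.single false true 1) := by
  rw [onQubit_mul, rotation_mul_single_true]
  simp

/-- `R₁` sets the control to `1`, so that the inverse walk steps `Y` are active; `R₂` resets it, as
signal processing starts from `0`. The final projection to control `0` keeps the first polynomial
`A` and discards `B`. -/
theorem block_eq {κ μ : Type} [Fintype κ] [DecidableEq κ] [Fintype μ]
    {S R₁ R₂ lo up A B Y : Matrix κ κ ℂ} {E₀ E₁ : Matrix κ μ ℂ}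
    (hS : S * lo = lo * A + up * B) (hR₁ : R₁ * E₀ = E₁) (hR₂ : R₂ * up = lo)
    (hE₁ : up * E₁ = E₁) (hup : E₀ᴴ * up = 0) (hlo : E₀ᴴ * lo = E₁ᴴ) (hY : Y * up = up * Y) :
    E₀ᴴ * (S * R₂ * Y * R₁ * E₀) = E₁ᴴ * (A * Y * E₁) := by
  have h1 : Y * E₁ = up * (Y * E₁) := by
    rw [← Matrix.mul_assoc, ← hY, Matrix.mul_assoc, hE₁]
  have h2 : S * R₂ * Y * R₁ * E₀ = (lo * A + up * B) * (Y * E₁) := by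
    calc S * R₂ * Y * R₁ * E₀ = S * (R₂ * (Y * (R₁ * E₀))) := by simp only [Matrix.mul_assoc]
      _ = S * (R₂ * (up * (Y * E₁))) := by rw [hR₁, ← h1]
      _ = S * (R₂ * up) * (Y * E₁) := by simp only [Matrix.mul_assoc]
      _ = _ := by rw [hR₂, hS]
  calc E₀ᴴ * (S * R₂ * Y * R₁ * E₀)
      = E₀ᴴ * lo * (A * (Y * E₁)) + E₀ᴴ * up * (B * (Y * E₁)) := by
        rw [h2, Matrix.add_mul, Matrix.mul_add]
        simp only [Matrix.mul_assoc]
    _ = E₁ᴴ * (A * Y * E₁) := by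
        rw [hlo, hup, Matrix.zero_mul, add_zero, Matrix.mul_assoc A]

theorem op_simulationCircuit (k : ℕ) (L : List (ℂ × ℂ)) :
    Circuit.op O (simulationCircuit n k L) =
      Circuit.op O (signalCircuit wireQ (walkCircuit n (numQubits n)) L) *
        onQubit wireQ (rotation (0, -1)) *
        (Circuit.op O (walkCircuit n (numQubits n)))ᴴ ^ k * onQubit wireQ (rotation (0, 1)) := by
  rw [simulationCircuit, Circuit.op, Circuit.op_append, Circuit.op,
    op_rotationStep O _ (by simp), op_rotationStep O _ (by simp), op_flatten_replicate,
    Circuit.op_inv]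

theorem walk_conjTranspose_pow_mul_upper (m k : ℕ) (O : Matrix.unitaryGroup (Fin m → Bool) ℂ) :
    (Circuit.op O (walkCircuit n m))ᴴ ^ k * onQubit wireQ (Matrix.single true true 1) =
      onQubit wireQ (Matrix.single true true 1) * (Circuit.op O (walkCircuit n m))ᴴ ^ k := by
  have h := congrArg Matrix.conjTranspose (walk_mul_upper n m O)
  rw [Matrix.conjTranspose_mul, Matrix.conjTranspose_mul, onQubit_conjTranspose,
    Matrix.conjTranspose_single, star_one] at h
  exact (Commute.pow_right (show Commute _ _ from h) k).symm

/-- The block of the simulation circuit is the truncated exponential series. -/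
theorem encodeReg_mul_op_simulationCircuit (hx : ∀ j, 0 ≤ x j) (hO : PreparesSqrt x O)
    {t s : ℝ} {k : ℕ} {L : List (ℂ × ℂ)} (hL : ∀ r ∈ L, ‖r.1‖ ^ 2 + ‖r.2‖ ^ 2 = 1)
    (hLP : (signalPair L).1 = evolutionPoly t s k) :
    (encodeReg n false)ᴴ * (Circuit.op O (simulationCircuit n k L) * encodeReg n false) =
      (s : ℂ)⁻¹ • ∑ i ∈ Finset.range k, evolutionCoeff t i • extended (circ x) ^ i := by
  -- The intertwining relation extends to powers, so a polynomial in `(G + G†)/2` acts on encoded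
  -- vectors as the same polynomial in the Hamiltonian.
  have hpow := fun i => pow_mul_of_mul_eq (walk_add_conjTranspose_mul_encodeReg hx hO) i
  rw [op_simulationCircuit, block_eq (op_signalCircuit wireQ _ O (walk_mul_lower n _ O true)
      (walk_mul_upper n _ O) L hL) rotation_mul_encodeReg (rotation_mul_upper _)
      upper_mul_encodeReg encodeReg_mul_upper encodeReg_mul_lower
      (walk_conjTranspose_pow_mul_upper _ k O), hLP,
    aeval_evolutionPoly_mul (Circuit.op_mul_conjTranspose O _) (Circuit.conjTranspose_op_mul O _),
    Matrix.smul_mul, Matrix.mul_smul, Matrix.sum_mul, Matrix.mul_sum]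
  congr 1
  refine Finset.sum_congr rfl fun i _ => ?_
  rw [Matrix.smul_mul, Matrix.mul_smul, hpow, ← Matrix.mul_assoc, encodeReg_conjTranspose_mul,
    Matrix.one_mul, _root_.smul_pow, smul_smul, mul_assoc,
    inv_mul_cancel₀ (pow_ne_zero i two_ne_zero), mul_one]

section
open scoped Matrix.Norms.L2Operator

/-- The Hamiltonian is the compression of `(G + G†)/2`, with `G` unitary, by an isometry. -/
theorem norm_extended_circ_le [NeZero n] (hx : ∀ j, 0 ≤ x j) (hO : PreparesSqrt x O) :
    ‖extended (circ x)‖ ≤ 1 := by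
  set G := Circuit.op O (walkCircuit n (numQubits n)) with hG
  have hG2 : Gᴴ * G = 1 := Circuit.conjTranspose_op_mul O _
  have hn1 : ‖G‖ = 1 := norm_le_one_of_isometry hG2
  have hn2 : ‖encodeReg n true‖ = 1 := norm_le_one_of_isometry (encodeReg_conjTranspose_mul true)
  have h := congrArg (fun A => (encodeReg n true)ᴴ * A)
    (walk_add_conjTranspose_mul_encodeReg hx hO)
  simp only [← Matrix.mul_assoc] at h
  rw [encodeReg_conjTranspose_mul, Matrix.one_mul, Matrix.mul_assoc] at h
  have h1 : ‖(2 : ℂ) • extended (circ x)‖ ≤ 2 := by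
    rw [← h]
    calc _ ≤ ‖(encodeReg n true)ᴴ‖ * (‖G + Gᴴ‖ * ‖encodeReg n true‖) :=
          (Matrix.l2_opNorm_mul _ _).trans
            (mul_le_mul_of_nonneg_left (Matrix.l2_opNorm_mul _ _) (norm_nonneg _))
      _ ≤ 1 * ((1 + 1) * 1) := by
          rw [Matrix.l2_opNorm_conjTranspose, hn2]
          gcongr
          refine (norm_add_le _ _).trans ?_
          rw [Matrix.l2_opNorm_conjTranspose, hn1]
      _ = 2 := by norm_num
  rw [norm_smul, Complex.norm_ofNat] at h1
  linarith

/-- With `δ = ε²/4` the block error is `2 δ = ε²/2`, exactly what `norm_sub_le_of_isometry` converts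
into `ε`. -/
theorem specNorm_simulation_le [NeZero n] (hx : ∀ j, 0 ≤ x j) (hO : PreparesSqrt x O)
    {t ε : ℝ} (ht0 : 0 ≤ t) (hε : 0 ≤ ε) {k : ℕ} (ht : t / (k + 1) ≤ 1 / 2)
    (hk : 2 * (t ^ k / k.factorial) ≤ ε ^ 2 / 4) {L : List (ℂ × ℂ)}
    (hL : ∀ r ∈ L, ‖r.1‖ ^ 2 + ‖r.2‖ ^ 2 = 1)
    (hLP : (signalPair L).1 = evolutionPoly t (1 + ε ^ 2 / 4) k) :
    specNorm (Circuit.op O (simulationCircuit n k L) * encodeReg n false -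
      encodeReg n false * evolution (extended (circ x)) t) ≤ ε := by
  refine norm_sub_le_of_isometry ?_ (encodeReg_conjTranspose_mul false)
    (evolution_conjTranspose_mul extended_circ_conjTranspose t)
    (encodeReg_mul_op_simulationCircuit hx hO hL hLP) hε ?_
  · rw [Matrix.conjTranspose_mul, Matrix.mul_assoc, ← Matrix.mul_assoc _ _ (encodeReg n false),
      Circuit.conjTranspose_op_mul, Matrix.one_mul, encodeReg_conjTranspose_mul]
  · refine (norm_truncated_sub_evolution_le extended_circ_conjTranspose
      (norm_extended_circ_le hx hO) ht0 ht hk).trans ?_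
    linarith

theorem specNorm_submatrix {κ κ' μ : Type} [Fintype κ] [Fintype κ'] [Fintype μ] [DecidableEq κ]
    [DecidableEq κ'] [DecidableEq μ] (A : Matrix κ μ ℂ) {e : κ' → κ}
    (he : Function.Bijective e) : specNorm (A.submatrix e id) = specNorm A :=
  norm_submatrix_equiv A he

end

/-- The numbering of the ancilla wires. -/
noncomputable def regEquiv (n : ℕ) :
    Reg (numQubits n) ≃ Wires n (Fintype.card (Anc (numQubits n))) :=
  Equiv.sumCongr (Equiv.refl _) (Equiv.sumCongr (Equiv.refl _) (Fintype.equivFin _))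

theorem encode_eq_submatrix (n : ℕ) : encode n (Fintype.card (Anc (numQubits n))) =
    (encodeReg n false).submatrix (fun b => b ∘ regEquiv n) id := by
  ext b v
  have h : encodeBits n _ v ∘ regEquiv n = encodedBits false v := by
    funext w
    rcases w with _ | i | (i | i) | (_ | _) | ⟨i, k⟩ <;> rfl
  simp only [encode, Matrix.submatrix_apply, encodeReg, ← h, id]
  congr 1
  rw [eq_iff_iff]
  exact ((comp_equiv_bijective (regEquiv n)).injective.eq_iff).symm

theorem implements_relabel (c : Circuit (Reg (numQubits n)) (numQubits n))
    {U : Matrix (Bool × Fin n) (Bool × Fin n) ℂ} {ε : ℝ}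
    (h : specNorm (Circuit.op O c * encodeReg n false - encodeReg n false * U) ≤ ε) :
    Implements (c.map (Step.relabel (regEquiv n))) O U ε := by
  rw [Implements, Circuit.op_relabel, encode_eq_submatrix]
  have hb := comp_equiv_bijective (regEquiv n)
  have h1 : (encodeReg n false).submatrix (fun b => b ∘ regEquiv n) id * U =
      (encodeReg n false * U).submatrix (fun b => b ∘ regEquiv n) id := rfl
  rw [h1, ← Matrix.submatrix_mul _ _ _ _ _ hb]
  exact (specNorm_submatrix (Circuit.op O c * encodeReg n false - encodeReg n false * U) hb).trans_le h

end Simulation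

end QSim

/-! ### Assembly and constants. -/

theorem theorem1 :
    ∃ C : ℝ, 0 < C ∧
      ∀ (n : ℕ) (t ε : ℝ), 2 ≤ n → 0 < t → 0 < ε → 1 < Real.log (t / ε) →
        ∃ (a : ℕ) (c : QSim.Circuit (QSim.Wires n a) (QSim.numQubits n)),
          (c.calls : ℝ) ≤ C * (max 1 t * QSim.rate t ε) ∧
          (c.gates : ℝ) ≤ C * (max 1 t * Real.log n * QSim.rate t ε) ∧
          ∀ x : Fin n → ℝ, (∀ j, 0 ≤ x j) → ∑ j, x j = 1 →
            ∀ O : Matrix.unitaryGroup (Fin (QSim.numQubits n) → Bool) ℂ,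
              QSim.PreparesSqrt x O →
                QSim.Implements c O (QSim.evolution (QSim.extended (QSim.circ x)) t) ε := by
  -- The gate count dictates the constant: it is at most `51569 r m`, where `m ≤ 3 log n`.
  refine ⟨200000, by norm_num, fun n t ε hn ht hε hlog => ?_⟩
  have hk := QSim.pow_div_factorial_numTerms ht hε hlog
  have hk2 := QSim.two_mul_le_numTerms ht hlog
  have hk3 := QSim.numTerms_le hlog
  have hr := QSim.one_le_max_mul_rate hlog
  set k := QSim.numTerms t ε
  set r := max 1 t * QSim.rate t ε
  have htk : t / (k + 1) ≤ 1 / 2 := by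
    rw [div_le_iff₀ (by positivity)]
    linarith
  obtain ⟨L, hLlen, hL, hLP⟩ := QSim.exists_signalPair_evolutionPoly (s := 1 + ε ^ 2 / 4)
    ht.le htk (by linarith)
  have : NeZero n := ⟨by omega⟩
  refine ⟨_, (QSim.simulationCircuit n k L).map (QSim.Step.relabel (QSim.regEquiv n)), ?_, ?_,
    fun x hx _ O hO => QSim.implements_relabel _
      (QSim.specNorm_simulation_le hx hO ht.le hε.le htk hk.le hL hLP)⟩
  · rw [QSim.Circuit.calls_relabel, QSim.calls_simulationCircuit, hLlen]
    push_cast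
    linarith
  · rw [QSim.Circuit.gates_relabel, QSim.gates_simulationCircuit, hLlen]
    have hm := QSim.numQubits_le hn
    have hm1 : (1 : ℝ) ≤ QSim.numQubits n := by
      have : 1 ≤ QSim.numQubits n := Nat.clog_pos (by norm_num) hn
      exact_mod_cast this
    push_cast
    set μ : ℝ := (QSim.numQubits n : ℝ)
    -- There are `k` inverse walk steps and `2 k + 1` signal processing steps, with `k ≤ 17 r` and
    -- `1 ≤ r`.
    have h1 : (3 * (k : ℝ) + 1) ≤ 52 * r := by linarith
    calc ((k : ℝ) + (2 * k + 1)) * (705 * μ + 286) + (2 * k + 1) + 2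
        = (3 * (k : ℝ) + 1) * (705 * μ + 286) + (2 * k + 3) := by ring
      _ ≤ (52 * r) * (991 * μ) + (37 * r) * μ := by
          refine add_le_add (mul_le_mul h1 (by linarith) (by positivity) (by positivity)) ?_
          calc 2 * (k : ℝ) + 3 ≤ 37 * r := by linarith
            _ ≤ 37 * r * μ := le_mul_of_one_le_right (by positivity) hm1
      _ = r * (51569 * μ) := by ring
      _ ≤ r * (51569 * (3 * Real.log n)) := by gcongr
      _ ≤ r * (200000 * Real.log n) := by
          have : 0 ≤ Real.log n := Real.log_natCast_nonneg n
          gcongr r * ?_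
          linarith
      _ = 200000 * (max 1 t * Real.log n * QSim.rate t ε) := by ring
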